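/- Let $\Bbbk$ be an algebraically closed field and let $A=\bigoplus_{d\in\mathbb Z}A_d$ be a unital $\mathbb Z$-graded associative $\Bbbk$-algebra equipped with mutually orthogonal homogeneous idempotents $1_i$ ($i\in\mathbf I$; some may be zero) such that $A=\bigoplus_{i,j\in\mathbf I}1_iA1_j$. Assume that every $1_iA_d1_j$ is finite-dimensional and that for all $i,j\in\mathbf I$ there is $N_{i,j}\in\mathbb Z$ with $1_iA_d1_j=0$ for $d<N_{i,j}$. Suppose that $A$ has a graded triangular basis, that is, the following data: a subset $\mathbf S\subseteq\mathbf I$; a poset $(\Lambda,\le)$ in which $\{\mu:\mu\le\lambda\}$ is finite for every $\lambda$; a function $\mathbf S\to\Lambda$, $s\mapsto\dot s$, with finite fibers $\mathbf S_\lambda$; and sets of homogeneous elements $\mathrm X(i,s)\subset 1_iA1_s$, $\mathrm H(s,t)\subset 1_sA1_t$, $\mathrm Y(t,j)\subset 1_tA1_j$ for $i,j\in\mathbf I$, $s,t\in\mathbf S$, such that, writing $\mathrm X(s)=\bigcup_i\mathrm X(i,s)$ and $\mathrm Y(t)=\bigcup_j\mathrm Y(t,j)$: - the products $xhy$ for $(x,h,y)\in\bigcup_{s,t\in\mathbf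 S}\mathrm X(s)\times\mathrm H(s,t)\times\mathrm Y(t)$ form a basis of $A$; - $\mathrm X(s,s)=\mathrm Y(s,s)=\{1_s\}$ for all $s\in\mathbf S$; - for $s\ne t$ in $\mathbf S$: $\mathrm X(s,t)\ne\varnothing\Rightarrow\dot s>\dot t$; $\mathrm H(s,t)\ne\varnothing\Rightarrow\dot s=\dot t$; $\mathrm Y(s,t)\ne\varnothing\Rightarrow\dot s<\dot t$; - for each $i\in\mathbf I\setminus\mathbf S$ there are only finitely many $s\in\mathbf S$ with $\mathrm X(i,s)\cup\mathrm Y(s,i)\ne\varnothing$. For $\lambda\in\Lambda$ let $e_\lambda=\sum_{s\in\mathbf S_\lambda}1_s$, let $A_{\ge\lambda}$ be the quotient of $A$ by the two-sided ideal generated by all $e_\mu$ with $\mu\not\ge\lambda$, let $\bar e_\lambda$ be the image of $e_\lambda$ in $A_{\ge\lambda}$, and let $A_\lambda=\bar e_\lambda A_{\ge\lambda}\bar e_\lambda$, a unital graded algebra. A unital graded algebra is called left (right) graded Noetherian if every finitely generated projective graded left (right) module satisfies the ascending chain condition on graded submodules. It has finite left (right) graded global dimension if there is $N\in\mathbb N$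 such that every graded left (right) module has a resolution of length at most $N$ by projective objects of the category of graded left (right) modules and degree-preserving homomorphisms. Theorem. Assume that $A$ is both left and right graded Noetherian and that each $A_\lambda$ $(\lambda\in\Lambda)$ has finite left or finite right graded global dimension. Then $A$ has finite left graded global dimension and finite right graded global dimension. -/

import Mathlib

universe u v w w'

section GradedModules

/-- A graded left module over a ring `R` with grading `𝒜`, where `𝒜 d` is the degree `d` part:
an `R`-module with a direct sum decomposition into additive subgroups `gr d`, `d : ℤ`, such that
`𝒜 c • gr d ⊆ gr (c + d)`. When `R` is an algebra over a field `k`, the module is automatically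
`k`-linear, through the structure map `k → R`. -/
structure GrMod {R : Type u} [Ring R] (𝒜 : ℤ → AddSubgroup R) where
  carrier : Type u
  [addCommGroup : AddCommGroup carrier]
  [module : Module R carrier]
  gr : ℤ → AddSubgroup carrier
  [decomposition : DirectSum.Decomposition gr]
  [gradedSMul : SetLike.GradedSMul 𝒜 gr]

attribute [instance] GrMod.addCommGroup GrMod.module GrMod.decomposition GrMod.gradedSMul

instance {R : Type u} [Ring R] (𝒜 : ℤ → AddSubgroup R) : CoeSort (GrMod 𝒜) (Type u) :=
  ⟨GrMod.carrier⟩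

namespace GrMod

variable {R : Type u} [Ring R] {𝒜 : ℤ → AddSubgroup R}

/-- Degree-preserving module homomorphisms: the morphisms of the category of graded modules. -/
structure Hom (V W : GrMod 𝒜) extends V →ₗ[R] W where
  map_gr : ∀ (d : ℤ), ∀ x ∈ V.gr d, toLinearMap x ∈ W.gr d

instance (V W : GrMod 𝒜) : CoeFun (Hom V W) (fun _ => V → W) := ⟨fun f => f.toLinearMap⟩

/-- Projective objects of the category of graded modules (whose epimorphisms are the surjective
homomorphisms). -/
def IsProjective (P : GrMod 𝒜) : Prop :=
  ∀ (V W : GrMod 𝒜) (g : Hom V W) (f : Hom P W), Function.Surjective g →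
    ∃ h : Hom P V, ∀ x : P, g (h x) = f x

/-- `V` has graded projective dimension at most `n`: there is an exact sequence
`0 → P n → ⋯ → P 1 → P 0 → V → 0` of graded modules with all `P i` graded projective. -/
def ProjDimLE (V : GrMod 𝒜) (n : ℕ) : Prop :=
  ∃ (P : ℕ → GrMod 𝒜) (d : ∀ i, Hom (P (i + 1)) (P i)) (ε : Hom (P 0) V),
    (∀ i, (P i).IsProjective) ∧
    (∀ i, n < i → Subsingleton (P i)) ∧
    Function.Surjective ε ∧
    Function.Exact (d 0) ε ∧
    ∀ i, Function.Exact (d (i + 1)) (d i)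

/-- The ascending chain condition on graded submodules. -/
def GradedACC (V : GrMod 𝒜) : Prop :=
  ∀ N : ℕ →o Submodule R V, (∀ n, (N n).IsHomogeneous V.gr) → ∃ n, ∀ m, n ≤ m → N m = N n

end GrMod

variable {R : Type u} [Ring R]

/-- The grading of the opposite ring. Graded left modules over `Rᵐᵒᵖ` with this grading
are graded right modules over `R`. -/
def opGrading (𝒜 : ℤ → AddSubgroup R) (d : ℤ) : AddSubgroup Rᵐᵒᵖ :=
  (𝒜 d).map (MulOpposite.opAddEquiv (α := R)).toAddMonoidHom

/-- Left graded Noetherian: every finitely generated projective graded left module satisfies the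
ascending chain condition on graded submodules. -/
def LeftGradedNoetherian (𝒜 : ℤ → AddSubgroup R) : Prop :=
  ∀ P : GrMod 𝒜, P.IsProjective → Module.Finite R P → P.GradedACC

/-- Right graded Noetherian. -/
def RightGradedNoetherian (𝒜 : ℤ → AddSubgroup R) : Prop :=
  LeftGradedNoetherian (opGrading 𝒜)

/-- Finite left graded global dimension: the graded projective dimensions of all graded left
modules are bounded by a common natural number. -/
def FiniteLeftGradedGlobalDim (𝒜 : ℤ → AddSubgroup R) : Prop :=
  ∃ n : ℕ, ∀ V : GrMod 𝒜, V.ProjDimLE n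

/-- Finite right graded global dimension. -/
def FiniteRightGradedGlobalDim (𝒜 : ℤ → AddSubgroup R) : Prop :=
  FiniteLeftGradedGlobalDim (opGrading 𝒜)

end GradedModules

section TriangularBases

variable {k : Type v} [Field k] {A : Type u} [Ring A] [Algebra k A]

/-- The subspace `x A y` of `A`. -/
def sandwich (k : Type v) [Field k] {A : Type u} [Ring A] [Algebra k A] (x y : A) :
    Submodule k A :=
  LinearMap.range (LinearMap.mulLeftRight k (x, y))

/-- A family `1_i` (`i : I`), written `e i`, of mutually orthogonal homogeneous idempotents of a
(here unital) graded algebra `A` such that `A = ⨁ 1_i A 1_j`. -/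
structure IsLocallyUnital (𝒜 : ℤ → Submodule k A) {I : Type w} (e : I → A) : Prop where
  orthogonal : OrthogonalIdempotents e
  homogeneous : ∀ i, SetLike.IsHomogeneousElem 𝒜 (e i)
  isInternal : open Classical in
    DirectSum.IsInternal (fun p : I × I => sandwich k (e p.1) (e p.2))

/-- Every space `1_i A_d 1_j` is finite-dimensional. -/
def LocallyFiniteDim (𝒜 : ℤ → Submodule k A) {I : Type w} (e : I → A) : Prop :=
  ∀ (i j : I) (d : ℤ),
    FiniteDimensional k ((𝒜 d).map (LinearMap.mulLeftRight k (e i, e j)))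

/-- For all `i, j`, one has `1_i A_d 1_j = 0` for all sufficiently small `d`. -/
def BoundedBelow (𝒜 : ℤ → Submodule k A) {I : Type w} (e : I → A) : Prop :=
  ∀ i j : I, ∃ N : ℤ, ∀ d < N, (𝒜 d).map (LinearMap.mulLeftRight k (e i, e j)) = ⊥

/-- A graded triangular basis of the graded algebra `A` with distinguished idempotents `e i`
and weight poset `L`. -/
structure GradedTriangularBasis (𝒜 : ℤ → Submodule k A) {I : Type w} (e : I → A)
    (L : Type w') [PartialOrder L] where
  /-- The indices of the special idempotents. -/
  S : Set I
  lower_finite : ∀ l : L, (Set.Iic l).Finite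
  dot : S → L
  finite_fiber : ∀ l : L, {s : S | dot s = l}.Finite
  X : I → S → Set A
  H : S → S → Set A
  Y : S → I → Set A
  X_mem : ∀ i s, ∀ x ∈ X i s, SetLike.IsHomogeneousElem 𝒜 x ∧ x ∈ sandwich k (e i) (e s)
  H_mem : ∀ s t, ∀ h ∈ H s t, SetLike.IsHomogeneousElem 𝒜 h ∧ h ∈ sandwich k (e s) (e t)
  Y_mem : ∀ t j, ∀ y ∈ Y t j, SetLike.IsHomogeneousElem 𝒜 y ∧ y ∈ sandwich k (e t) (e j)
  /-- The products `x h y`, for `(x, h, y)` in the union over `s, t` of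
  `X(s) × H(s,t) × Y(t)`, where `X(s) = ⋃ i, X(i,s)` and `Y(t) = ⋃ j, Y(t,j)`, form a basis. -/
  linearIndependent : LinearIndependent k
    (fun p : (⋃ (s : S) (t : S), (⋃ i, X i s) ×ˢ (H s t ×ˢ ⋃ j, Y t j) : Set (A × A × A)) =>
      p.1.1 * p.1.2.1 * p.1.2.2)
  span_eq_top : Submodule.span k (Set.range
    (fun p : (⋃ (s : S) (t : S), (⋃ i, X i s) ×ˢ (H s t ×ˢ ⋃ j, Y t j) : Set (A × A × A)) =>
      p.1.1 * p.1.2.1 * p.1.2.2)) = ⊤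
  X_self : ∀ s : S, X s s = {e s}
  Y_self : ∀ s : S, Y s s = {e s}
  X_ne : ∀ s t : S, s ≠ t → (X s t).Nonempty → dot t < dot s
  H_ne : ∀ s t : S, s ≠ t → (H s t).Nonempty → dot s = dot t
  Y_ne : ∀ s t : S, s ≠ t → (Y s t).Nonempty → dot s < dot t
  finite_ne : ∀ i, i ∉ S → {s : S | (X i s ∪ Y s i).Nonempty}.Finite

namespace GradedTriangularBasis

variable {𝒜 : ℤ → Submodule k A} {I : Type w} {e : I → A} {L : Type w'} [PartialOrder L]
  (T : GradedTriangularBasis 𝒜 e L)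

/-- The weight idempotent `e_λ`, the sum of the `1_s` with `dot s = λ`. -/
noncomputable def weightIdem (l : L) : A := ∑ s ∈ (T.finite_fiber l).toFinset, e s

/-- The congruence modulo the two-sided ideal generated by all `e_μ` with `μ ≱ λ`. -/
def upperCon (l : L) : RingCon A :=
  (TwoSidedIdeal.span {a : A | ∃ m : L, ¬ l ≤ m ∧ a = T.weightIdem m}).ringCon

/-- The quotient algebra `A_{≥ λ}`. -/
abbrev Upper (l : L) : Type u := (T.upperCon l).Quotient

/-- The image of `e_λ` in `A_{≥ λ}`. -/
noncomputable def upperIdem (l : L) : T.Upper l := (T.upperCon l).mk' (T.weightIdem l)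

theorem isIdempotentElem_weightIdem (hA : IsLocallyUnital 𝒜 e) (l : L) :
    IsIdempotentElem (T.weightIdem l) := by
  classical
  have h : OrthogonalIdempotents (fun s : T.S => e s) :=
    ⟨fun s => hA.orthogonal.idem s,
      fun s t hst => hA.orthogonal.ortho (fun h => hst (Subtype.ext h))⟩
  exact h.isIdempotentElem_sum

theorem isIdempotentElem_upperIdem (hA : IsLocallyUnital 𝒜 e) (l : L) :
    IsIdempotentElem (T.upperIdem l) :=
  (T.isIdempotentElem_weightIdem hA l).map (T.upperCon l).mk'

/-- The algebra `A_λ = ē_λ A_{≥ λ} ē_λ`, a unital ring with identity `ē_λ`. -/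
abbrev Cartan (hA : IsLocallyUnital 𝒜 e) (l : L) : Type u :=
  (T.isIdempotentElem_upperIdem hA l).Corner

/-- The grading of `A_λ`: the degree `d` part consists of the elements of `A_λ` that are images
of elements of `A_d`. -/
def cartanGrading (hA : IsLocallyUnital 𝒜 e) (l : L) (d : ℤ) : AddSubgroup (T.Cartan hA l) where
  carrier := {x | ∃ a ∈ 𝒜 d, (T.upperCon l).mk' a = (x.1 : T.Upper l)}
  add_mem' := by
    rintro x y ⟨a, ha, hx⟩ ⟨b, hb, hy⟩
    exact ⟨a + b, add_mem ha hb, (map_add _ a b).trans (congrArg₂ (· + ·) hx hy)⟩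
  zero_mem' := ⟨0, zero_mem _, map_zero _⟩
  neg_mem' := by
    rintro x ⟨a, ha, hx⟩
    exact ⟨-a, neg_mem ha, (map_neg _ a).trans (congrArg (- ·) hx)⟩

end GradedTriangularBasis

end TriangularBases

/-! Everything is moved to ungraded left modules, where the argument is a one-sided stratification
of `A` by weights.

Ungrading. For a ℤ-graded ring, graded projective means graded and projective, and finite graded
global dimension is equivalent to finite global dimension. From graded to ungraded one uses the
sequence 0 → M[t, t⁻¹] → M[t, t⁻¹] → M → 0 given by multiplication by t - 1 and evaluation at t = 1,
in which M[t, t⁻¹] is a graded module (`ProjDimLT.of_laurent`). Since 1 is a finite sum of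
idempotents `e i`, the grading of `A` is bounded below, and comparing ideals of leading terms turns
graded Noetherian into Noetherian on both sides (`LeftGradedNoetherian.isNoetherianRing`).

Left and right. Over a left Noetherian ring, finite right global dimension implies finite left
global dimension (`FiniteLeftGlobalDim.of_op`): character modules of finitely generated left modules
have bounded injective dimension as right modules, this bounds the projective dimension of the left
modules, and by Auslander's theorem finitely generated modules suffice. So every `A_λ` may be
assumed to have finite left global dimension, it is enough to bound the left global dimension of
`A`, and the right one follows.

Stratification. For a lower set Γ of weights, the ideal generated by the `e_μ` with μ ∈ Γ is exactly
the span of the basis elements `x h y` of weight in Γ (`weightCon_mk'_eq_zero`). Let λ be minimal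
outside Γ, R = A/I_Γ, and e the image of `e_λ`. Then eRe is `A_λ`, and the left module ReR has the
elements y of left weight λ as generators, with only the relations 1_t y = y; hence ReR is left
projective and eR is projective over eRe (`isLeftStratifying`). This bounds the left global
dimension of R in terms of those of R/ReR and eRe (`IsLeftStratifying.finiteLeftGlobalDim`). As 1
involves finitely many basis elements, some finite lower set Γ has A/I_Γ = 0; removing maximal
weights one at a time leads from the zero ring to `A`. -/

open CategoryTheory

/-! ### Projective dimension of modules, with strict bounds: `< 1` means projective -/

section ProjectiveDimension

/-- The projective dimension of the module `M` is smaller than `n`. -/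
def ProjDimLT (R : Type u) [Ring R] (M : Type u) [AddCommGroup M] [Module R M] (n : ℕ) : Prop :=
  HasProjectiveDimensionLT (ModuleCat.of R M) n

/-- The left global dimension of `R` is smaller than `n`. -/
def LeftGlobalDimLT (R : Type u) [Ring R] (n : ℕ) : Prop :=
  ∀ (M : Type u) [AddCommGroup M] [Module R M], ProjDimLT R M n

/-- The left global dimension of `R` is finite. -/
def FiniteLeftGlobalDim (R : Type u) [Ring R] : Prop := ∃ n, LeftGlobalDimLT R n

variable {R : Type u} [Ring R] {L M N : Type u} [AddCommGroup L] [Module R L]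
  [AddCommGroup M] [Module R M] [AddCommGroup N] [Module R N]

namespace ProjDimLT

theorem mono {m n : ℕ} (h : ProjDimLT R M m) (hmn : m ≤ n) : ProjDimLT R M n :=
  have : HasProjectiveDimensionLT (ModuleCat.of R M) m := h
  hasProjectiveDimensionLT_of_ge _ m n hmn

theorem of_projective [Module.Projective R M] {n : ℕ} (hn : 0 < n) : ProjDimLT R M n := by
  have : Projective (ModuleCat.of R M) := (IsProjective.iff_projective M).1 ‹_›
  have h : ProjDimLT R M 1 := inferInstanceAs (HasProjectiveDimensionLT (ModuleCat.of R M) 1)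
  exact h.mono hn

theorem projective (h : ProjDimLT R M 1) : Module.Projective R M := by
  rw [IsProjective.iff_projective M]
  exact projective_iff_hasProjectiveDimensionLT_one.2 h

theorem of_linearEquiv (e : M ≃ₗ[R] N) {n : ℕ} (h : ProjDimLT R M n) : ProjDimLT R N n :=
  have : HasProjectiveDimensionLT (ModuleCat.of R M) n := h
  hasProjectiveDimensionLT_of_iso e.toModuleIso n

theorem of_retract (i : M →ₗ[R] N) (r : N →ₗ[R] M) (hir : ∀ x, r (i x) = x) {n : ℕ}
    (h : ProjDimLT R N n) : ProjDimLT R M n :=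
  have : HasProjectiveDimensionLT (ModuleCat.of R N) n := h
  (⟨ModuleCat.ofHom i, ModuleCat.ofHom r, by ext x; exact hir x⟩ :
    Retract (ModuleCat.of R M) (ModuleCat.of R N)).hasProjectiveDimensionLT n

variable (f : L →ₗ[R] M) (g : M →ₗ[R] N)

theorem shortExact (hfg : Function.Exact f g) (hf : Function.Injective f)
    (hg : Function.Surjective g) :
    (ModuleCat.shortComplexOfCompEqZero f g hfg.linearMap_comp_eq_zero).ShortExact :=
  ModuleCat.shortComplex_shortExact _ hfg hf hg

variable {f g}

theorem middle (hfg : Function.Exact f g) (hf : Function.Injective f)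
    (hg : Function.Surjective g) {n : ℕ} (h₁ : ProjDimLT R L n) (h₃ : ProjDimLT R N n) :
    ProjDimLT R M n :=
  (shortExact f g hfg hf hg).hasProjectiveDimensionLT_X₂ n h₁ h₃

theorem right (hfg : Function.Exact f g) (hf : Function.Injective f)
    (hg : Function.Surjective g) {n : ℕ} (h₁ : ProjDimLT R L n) (h₂ : ProjDimLT R M (n + 1)) :
    ProjDimLT R N (n + 1) :=
  (shortExact f g hfg hf hg).hasProjectiveDimensionLT_X₃ n h₁ h₂

theorem left (hfg : Function.Exact f g) (hf : Function.Injective f)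
    (hg : Function.Surjective g) {n : ℕ} (h₂ : ProjDimLT R M n) (h₃ : ProjDimLT R N (n + 1)) :
    ProjDimLT R L n :=
  (shortExact f g hfg hf hg).hasProjectiveDimensionLT_X₁ n h₂ h₃

theorem of_ker (g : M →ₗ[R] N) (hg : Function.Surjective g) {n : ℕ}
    (h₁ : ProjDimLT R (LinearMap.ker g) n) (h₂ : ProjDimLT R M (n + 1)) : ProjDimLT R N (n + 1) :=
  right (LinearMap.exact_subtype_ker_map g) (LinearMap.ker g).injective_subtype hg h₁ h₂

theorem ker (g : M →ₗ[R] N) (hg : Function.Surjective g) {n : ℕ}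
    (h₂ : ProjDimLT R M n) (h₃ : ProjDimLT R N (n + 1)) : ProjDimLT R (LinearMap.ker g) n :=
  left (LinearMap.exact_subtype_ker_map g) (LinearMap.ker g).injective_subtype hg h₂ h₃

theorem of_quotient (P : Submodule R M) {n : ℕ} (h₁ : ProjDimLT R P n)
    (h₃ : ProjDimLT R (M ⧸ P) n) : ProjDimLT R M n :=
  middle (LinearMap.exact_subtype_mkQ P) P.injective_subtype P.mkQ_surjective h₁ h₃

end ProjDimLT

theorem LeftGlobalDimLT.mono {m n : ℕ} (h : LeftGlobalDimLT R m) (hmn : m ≤ n) :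
    LeftGlobalDimLT R n :=
  fun M _ _ => (h M).mono hmn

theorem FiniteLeftGlobalDim.exists_succ (h : FiniteLeftGlobalDim R) :
    ∃ n, LeftGlobalDimLT R (n + 1) :=
  h.imp fun _ hn => hn.mono (Nat.le_succ _)

theorem FiniteLeftGlobalDim.of_ringEquiv {S : Type u} [Ring S] (e : R ≃+* S)
    (h : FiniteLeftGlobalDim R) : FiniteLeftGlobalDim S := by
  obtain ⟨n, hn⟩ := h.exists_succ
  refine ⟨n + 1, fun M _ _ => ?_⟩
  let _ : Module R M := Module.compHom M (e : R →+* S)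
  have : HasProjectiveDimensionLE (ModuleCat.of R M) n := hn M
  let _ := RingHomInvPair.of_ringEquiv e
  let _ := RingHomInvPair.of_ringEquiv e.symm
  exact ModuleCat.hasProjectiveDimensionLE_of_semiLinearEquiv e
    (M := ModuleCat.of R M) (N := ModuleCat.of S M)
    { AddEquiv.refl M with map_smul' := fun _ _ => rfl } n

end ProjectiveDimension

/-! ### Auslander's theorem on global dimension -/

section Auslander

variable {R : Type u} [Ring R]

/-- The obstruction to extending a homomorphism I → N to R lies in Ext¹(R/I, N), by the long exact
sequence of 0 → I → R → R/I → 0. -/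
theorem Module.Baer.of_subsingleton_ext (N : ModuleCat.{u} R)
    (h : ∀ I : Ideal R, Subsingleton (Abelian.Ext (ModuleCat.of R (R ⧸ I)) N 1)) :
    Module.Baer R N := by
  intro I g
  have hS := ProjDimLT.shortExact _ _ (LinearMap.exact_subtype_mkQ I)
    I.injective_subtype I.mkQ_surjective
  obtain ⟨x, hx⟩ := Abelian.Ext.contravariant_sequence_exact₁ hS N
    (Abelian.Ext.mk₀ (ModuleCat.ofHom g)) (n₁ := 1) rfl (by
      have := h I
      exact Subsingleton.elim (α := Abelian.Ext (ModuleCat.of R (R ⧸ I)) N 1) _ _)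
  obtain ⟨y, rfl⟩ := Abelian.Ext.homEquiv₀.symm.surjective x
  refine ⟨y.hom, fun r hr => ?_⟩
  have h2 : Abelian.Ext.mk₀ (ModuleCat.ofHom I.subtype ≫ y) =
      Abelian.Ext.mk₀ (ModuleCat.ofHom g) := by
    rw [← hx, ← Abelian.Ext.mk₀_comp_mk₀]; rfl
  have h3 := Abelian.Ext.homEquiv₀.symm.injective h2
  exact LinearMap.congr_fun (congrArg ModuleCat.Hom.hom h3) ⟨r, hr⟩

/-- Baer's criterion in higher degree: embed N in an injective object and shift dimension to the
cokernel. -/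
theorem hasInjectiveDimensionLT_of_subsingleton_ext (n : ℕ) (N : ModuleCat.{u} R)
    (h : ∀ I : Ideal R, Subsingleton (Abelian.Ext (ModuleCat.of R (R ⧸ I)) N (n + 1))) :
    HasInjectiveDimensionLT N (n + 1) := by
  induction n generalizing N with
  | zero =>
    have := (Module.Baer.of_subsingleton_ext N h).injective
    have : Injective N := (Module.injective_iff_injective_object R N).1 this
    infer_instance
  | succ n ih =>
    obtain ⟨p⟩ := EnoughInjectives.presentation N
    have hS : (ShortComplex.mk _ _ (Limits.cokernel.condition p.f)).ShortExact :=
      { exact := ShortComplex.exact_cokernel p.f }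
    refine (hS.hasInjectiveDimensionLT_X₃_iff n p.injective).1 (ih _ fun I => ⟨fun x y => ?_⟩)
    suffices ∀ x : Abelian.Ext (ModuleCat.of R (R ⧸ I)) (Limits.cokernel p.f) (n + 1), x = 0 by
      rw [this x, this y]
    intro x
    have := h I
    obtain ⟨z, rfl⟩ := Abelian.Ext.covariant_sequence_exact₃ (ModuleCat.of R (R ⧸ I)) hS x rfl
      (Subsingleton.elim (α := Abelian.Ext (ModuleCat.of R (R ⧸ I)) N (n + 1 + 1)) _ _)
    rw [Abelian.Ext.eq_zero_of_injective z, Abelian.Ext.zero_comp]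

/-- Auslander's theorem: the global dimension is determined by finitely generated modules. -/
theorem LeftGlobalDimLT.of_finite {n : ℕ}
    (h : ∀ (M : Type u) [AddCommGroup M] [Module R M] [Module.Finite R M],
      ProjDimLT R M (n + 1)) : LeftGlobalDimLT R (n + 1) := by
  intro M _ _
  refine hasProjectiveDimensionLT_of_enoughInjectives _ _ fun N => ?_
  have := hasInjectiveDimensionLT_of_subsingleton_ext n N fun I => by
    have : HasProjectiveDimensionLT (ModuleCat.of R (R ⧸ I)) (n + 1) := h (R ⧸ I)
    exact HasProjectiveDimensionLT.subsingleton _ _ _ le_rfl _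
  exact HasInjectiveDimensionLT.subsingleton _ (n + 1) _ le_rfl _

theorem LeftGlobalDimLT.hasInjectiveDimensionLT {n : ℕ} (h : LeftGlobalDimLT R n)
    (N : ModuleCat.{u} R) : HasInjectiveDimensionLT N n := by
  refine hasInjectiveDimensionLT_of_enoughProjectives _ _ fun M => ?_
  have : HasProjectiveDimensionLT M n := h M
  exact HasProjectiveDimensionLT.subsingleton M n n le_rfl N

end Auslander

/-! ### Left versus right global dimension through character modules -/

section LeftRight

theorem exists_basis_surjective (R : Type u) [Ring R] (M : Type u) [AddCommGroup M]
    [Module R M] [Module.Finite R M] :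
    ∃ (n : ℕ) (F : Type u) (_ : AddCommGroup F) (_ : Module R F) (_ : Module.Basis (Fin n) R F)
      (g : F →ₗ[R] M), Function.Surjective g := by
  obtain ⟨n, g, hg⟩ := Module.Finite.exists_fin' R M
  exact ⟨n, _, _, _, Pi.basisFun R (Fin n), g, hg⟩

namespace CharacterModule

variable {R : Type u} [Ring R]

section

variable (M : Type u) [AddCommGroup M] [Module R M]

/-- The character module of a left module is a right module. -/
instance opModule : Module Rᵐᵒᵖ (CharacterModule M) where
  smul r c := AddMonoidHom.comp c (smulAddHom R M r.unop)
  one_smul c := by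
    ext x; change c ((1 : R) • x) = c x; rw [one_smul]
  mul_smul r s c := by
    ext x
    change c ((s.unop * r.unop) • x) = c (s.unop • r.unop • x)
    rw [mul_smul]
  smul_zero _ := rfl
  smul_add _ _ _ := rfl
  add_smul r s c := by
    ext x
    change c ((r.unop + s.unop) • x) = c (r.unop • x) + c (s.unop • x)
    rw [add_smul, map_add]
  zero_smul c := by
    ext x
    change c ((0 : R) • x) = 0
    rw [zero_smul, map_zero]

end

variable {L M N : Type u} [AddCommGroup L] [Module R L] [AddCommGroup M] [Module R M]
  [AddCommGroup N] [Module R N]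

theorem op_smul_apply (r : Rᵐᵒᵖ) (c : CharacterModule M) (x : M) : (r • c) x = c (r.unop • x) :=
  rfl

theorem add_apply' (c d : CharacterModule M) (x : M) : (c + d) x = c x + d x := rfl

theorem sum_apply {ι : Type*} (s : Finset ι) (c : ι → CharacterModule M) (x : M) :
    (∑ i ∈ s, c i) x = ∑ i ∈ s, c i x :=
  map_sum (AddMonoidHom.eval x : (M →+ AddCircle (1 : ℚ)) →+ AddCircle (1 : ℚ)) c s

/-- The transpose of a homomorphism of left modules. -/
def opDual (f : L →ₗ[R] M) : CharacterModule M →ₗ[Rᵐᵒᵖ] CharacterModule L where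
  toFun c := AddMonoidHom.comp c f.toAddMonoidHom
  map_add' _ _ := rfl
  map_smul' r c := by
    ext x
    change c (r.unop • f x) = c (f (r.unop • x))
    rw [map_smul f]

theorem opDual_injective {g : M →ₗ[R] N} (hg : Function.Surjective g) :
    Function.Injective (opDual g) := by
  intro c d h
  ext x
  obtain ⟨y, rfl⟩ := hg x
  exact DFunLike.congr_fun h y

theorem opDual_surjective {f : L →ₗ[R] M} (hf : Function.Injective f) :
    Function.Surjective (opDual f) :=
  dual_surjective_of_injective f.toAddMonoidHom.toIntLinearMap hf

theorem opDual_ker_subtype_surjective (g : M →ₗ[R] N) :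
    Function.Surjective (opDual (LinearMap.ker g).subtype) :=
  opDual_surjective (LinearMap.ker g).injective_subtype

/-- A character that vanishes on the image of f is constant on the fibres of g, so it descends to N.
-/
theorem opDual_exact {f : L →ₗ[R] M} {g : M →ₗ[R] N} (hfg : Function.Exact f g)
    (hg : Function.Surjective g) : Function.Exact (opDual g) (opDual f) := by
  intro c
  constructor
  · intro h
    have hc : ∀ x y, g x = g y → c x = c y := by
      intro x y hxy
      obtain ⟨z, hz⟩ := (hfg (x - y)).1 (by rw [map_sub, hxy, sub_self])
      have h1 : c (f z) = 0 := DFunLike.congr_fun h z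
      rw [← sub_eq_zero, ← map_sub, ← hz, h1]
    let s := Function.surjInv hg
    have hs : ∀ x, g (s x) = x := Function.surjInv_eq hg
    let d : N →+ AddCircle (1 : ℚ) :=
      AddMonoidHom.mk' (fun x => c (s x)) fun x y => by
        rw [← map_add]
        exact hc _ _ (by rw [map_add, hs, hs, hs])
    refine ⟨d, ?_⟩
    ext x
    exact hc _ _ (hs _)
  · rintro ⟨d, rfl⟩
    ext x
    change d (g (f x)) = 0
    rw [(hfg (f x)).2 ⟨x, rfl⟩, map_zero]

/-- A homomorphism g from X to the characters of a free module amounts to the characters x ↦ g x (b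
i) of X. Each extends to Y because ℚ/ℤ is injective, and the extensions ψ i reassemble to y ↦ (r • b
i ↦ ψ i (y r)). -/
theorem injective_of_basis {ι : Type} (b : Module.Basis ι R M) :
    Module.Injective Rᵐᵒᵖ (CharacterModule M) where
  out X Y _ _ _ _ f hf g := by
    let χ (i : ι) : CharacterModule X := AddMonoidHom.mk' (fun x => g x (b i))
      fun x y => by rw [map_add, add_apply']
    have hχ : ∀ i, ∃ ψ : CharacterModule Y, ∀ x, ψ (f x) = χ i x := fun i => by
      obtain ⟨ψ, hψ⟩ := dual_surjective_of_injective f.toAddMonoidHom.toIntLinearMap hf (χ i)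
      exact ⟨ψ, fun x => DFunLike.congr_fun hψ x⟩
    choose ψ hψ using hχ
    have hadd (y : Y) (i : ι) (r s : R) : ψ i (MulOpposite.op (r + s) • y) =
        ψ i (MulOpposite.op r • y) + ψ i (MulOpposite.op s • y) := by
      rw [MulOpposite.op_add, add_smul, map_add]
    let h' (y : Y) : (ι →₀ R) →+ AddCircle (1 : ℚ) := Finsupp.liftAddHom fun i =>
      AddMonoidHom.mk' (fun r : R => ψ i (MulOpposite.op r • y)) (hadd y i)
    let h (y : Y) : CharacterModule M := (h' y).comp b.repr.toLinearMap.toAddMonoidHom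
    have hh (y : Y) (i : ι) (r : R) : h y (r • b i) = ψ i (MulOpposite.op r • y) := by
      change h' y (b.repr (r • b i)) = _
      rw [map_smul, b.repr_self, Finsupp.smul_single, smul_eq_mul, mul_one]
      exact Finsupp.liftAddHom_apply_single (fun i =>
        AddMonoidHom.mk' (fun r : R => ψ i (MulOpposite.op r • y)) (hadd y i)) i r
    have hext : ∀ c d : CharacterModule M, (∀ i (r : R), c (r • b i) = d (r • b i)) → c = d := by
      intro c d hcd
      ext x
      rw [← b.linearCombination_repr x, Finsupp.linearCombination_apply, Finsupp.sum, map_sum,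
        map_sum]
      exact Finset.sum_congr rfl fun i _ => hcd i _
    refine ⟨⟨⟨h, fun x y => hext _ _ fun i r => ?_⟩, fun s y => hext _ _ fun i r => ?_⟩,
      fun x => hext _ _ fun i r => ?_⟩
    · rw [add_apply', hh, hh, hh, smul_add, map_add]
    · rw [RingHom.id_apply, op_smul_apply, hh, smul_smul]
      change _ = h y _
      rw [smul_smul, hh]
      rfl
    · change h (f x) _ = _
      rw [hh, ← map_smul, hψ]
      change g (MulOpposite.op r • x) _ = _
      rw [map_smul, op_smul_apply]
      rfl

/-- Over a left Noetherian ring, a finitely generated left module whose character module is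
injective is projective. -/
theorem projective_of_injective [IsNoetherianRing R] [Module.Finite R M]
    [Module.Injective Rᵐᵒᵖ (CharacterModule M)] : Module.Projective R M := by
  obtain ⟨n, F, _, _, b, g, hg⟩ := exists_basis_surjective R M
  have := Module.Finite.of_basis b
  have hex := LinearMap.exact_subtype_ker_map g
  have hinj := (LinearMap.ker g).injective_subtype
  have hsurj : Function.Surjective (opDual (LinearMap.ker g).subtype) :=
    opDual_ker_subtype_surjective g
  -- the transposed sequence splits
  obtain ⟨ρ, hρ⟩ := Module.Injective.extension_property Rᵐᵒᵖ _ _ _ (opDual g)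
    (opDual_injective hg) LinearMap.id
  have hsplit := (opDual_exact hex hg).split_tfae (opDual_injective hg) hsurj
  obtain ⟨σ, hσ⟩ := (hsplit.out 1 0).1
    (⟨ρ, hρ⟩ : ∃ ρ, ρ ∘ₗ opDual g = LinearMap.id)
  have hσ' : ∀ (c : CharacterModule (LinearMap.ker g)) (x : LinearMap.ker g), σ c x = c x :=
    fun c x => DFunLike.congr_fun (LinearMap.congr_fun hσ c) x
  obtain ⟨m, l, hl⟩ := Module.Finite.exists_fin (R := R) (M := LinearMap.ker g)
  -- a system of linear equations that is solvable in the free module is solvable in the kernel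
  let Φ : (Fin n → LinearMap.ker g) →+ (Fin m → LinearMap.ker g) :=
    AddMonoidHom.mk' (fun x i => ∑ j, b.repr (l i).1 j • x j) fun x y => by
      ext1 i
      simp only [Pi.add_apply, smul_add, Finset.sum_add_distrib]
  -- With l i = ∑ a_ij b_j, the claim is that ∑_j a_ij x_j = l i is solvable in the kernel.
  -- Otherwise a character of the cokernel of Φ is nonzero at l; its components φ i satisfy ∑_i φ i
  -- a_ij = 0. The section σ carries these relations to characters of F, where they can be evaluated
  -- at b_j, and summing over j gives ∑_i φ i (l i) = 0, a contradiction.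
  have hΦ : l ∈ Φ.range := by
    by_contra hnot
    obtain ⟨c, hc⟩ := exists_character_apply_ne_zero_of_ne_zero
      (a := (QuotientAddGroup.mk l : (Fin m → LinearMap.ker g) ⧸ Φ.range))
      (fun h => hnot ((QuotientAddGroup.eq_zero_iff l).1 h))
    apply hc
    let φ (i : Fin m) : CharacterModule (LinearMap.ker g) :=
      (AddMonoidHom.comp (AddMonoidHom.comp c (QuotientAddGroup.mk' Φ.range))
        (AddMonoidHom.single (fun _ : Fin m => LinearMap.ker g) i))
    have hφ (x : Fin m → LinearMap.ker g) :
        c (QuotientAddGroup.mk x) = ∑ i, φ i (x i) := by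
      conv_lhs => rw [← Finset.univ_sum_single x]
      exact map_sum (AddMonoidHom.comp c (QuotientAddGroup.mk' Φ.range)) _ _
    have hrel (j : Fin n) : ∑ i, MulOpposite.op (b.repr (l i).1 j) • φ i = 0 := by
      ext x
      have h1 : c (QuotientAddGroup.mk (Φ (Pi.single j x))) = 0 := by
        rw [(QuotientAddGroup.eq_zero_iff (N := Φ.range) (Φ (Pi.single j x))).2 ⟨_, rfl⟩]
        exact map_zero _
      rw [hφ] at h1
      rw [sum_apply]
      refine (Finset.sum_congr rfl fun i _ => ?_).trans h1
      rw [op_smul_apply]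
      congr 1
      change _ = ∑ j', b.repr (l i).1 j' • (Pi.single j x : Fin n → LinearMap.ker g) j'
      rw [Finset.sum_eq_single j]
      · rw [Pi.single_eq_same]
        rfl
      · intro b _ hb
        rw [Pi.single_eq_of_ne hb, smul_zero]
      · simp
    have hrel' (j : Fin n) : ∑ i, σ (φ i) (b.repr (l i).1 j • b j) = 0 := by
      have h1 := DFunLike.congr_fun (congrArg σ (hrel j)) (b j)
      rw [map_sum, sum_apply, map_zero] at h1
      refine (Finset.sum_congr rfl fun i _ => ?_).trans h1
      rw [map_smul σ, op_smul_apply]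
      rfl
    rw [hφ]
    have h2 : ∀ i, φ i (l i) = ∑ j, σ (φ i) (b.repr (l i).1 j • b j) := fun i => by
      rw [← hσ', ← map_sum, b.sum_repr]
    rw [Finset.sum_congr rfl fun i _ => h2 i, Finset.sum_comm]
    exact Finset.sum_eq_zero fun j _ => hrel' j
  obtain ⟨x, hx⟩ := hΦ
  -- The map b_j ↦ x_j fixes the generators l i of the kernel, so it is a retraction onto it.
  let r : F →ₗ[R] LinearMap.ker g := b.constr ℕ x
  have hr : r ∘ₗ (LinearMap.ker g).subtype = LinearMap.id := by
    refine LinearMap.ext_on_range hl fun i => ?_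
    change r (l i).1 = l i
    rw [b.constr_apply_fintype ℕ]
    exact congrFun hx i
  obtain ⟨s, hs⟩ := ((hex.split_tfae hinj hg).out 1 0).1
    (⟨r, hr⟩ : ∃ r, r ∘ₗ (LinearMap.ker g).subtype = LinearMap.id)
  have := Module.Projective.of_basis b
  exact Module.Projective.of_split s g hs

/-- Dualizing a finite free cover embeds the character module of M in an injective module whose
cokernel is the character module of the syzygy. So both dimensions drop together; the Noetherian
condition keeps the syzygies finitely generated. -/
theorem projDimLT_of_hasInjectiveDimensionLT [IsNoetherianRing R] {n : ℕ}
    (M : Type u) [AddCommGroup M] [Module R M] [Module.Finite R M]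
    (h : HasInjectiveDimensionLT (ModuleCat.of Rᵐᵒᵖ (CharacterModule M)) (n + 1)) :
    ProjDimLT R M (n + 1) := by
  induction n generalizing M with
  | zero =>
    have h1 : Injective (ModuleCat.of Rᵐᵒᵖ (CharacterModule M)) :=
      injective_iff_hasInjectiveDimensionLT_one.2 h
    have := (Module.injective_iff_injective_object Rᵐᵒᵖ (CharacterModule M)).2 h1
    have := projective_of_injective (R := R) (M := M)
    exact ProjDimLT.of_projective one_pos
  | succ n ih =>
    obtain ⟨m, F, _, _, b, g, hg⟩ := exists_basis_surjective R M
    have := Module.Projective.of_basis b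
    have := Module.Finite.of_basis b
    have hsurj : Function.Surjective (opDual (LinearMap.ker g).subtype) :=
      opDual_ker_subtype_surjective g
    have hS := ProjDimLT.shortExact _ _ (opDual_exact (LinearMap.exact_subtype_ker_map g) hg)
      (opDual_injective hg) hsurj
    have hI : Injective (ModuleCat.of Rᵐᵒᵖ (CharacterModule F)) :=
      (Module.injective_iff_injective_object Rᵐᵒᵖ _).1 (injective_of_basis b)
    exact ProjDimLT.of_ker g hg
      (ih (LinearMap.ker g) ((hS.hasInjectiveDimensionLT_X₃_iff n hI).2 h))
      (ProjDimLT.of_projective (Nat.succ_pos _))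

end CharacterModule

/-- A left Noetherian ring of finite right global dimension has finite left global dimension. -/
theorem FiniteLeftGlobalDim.of_op {R : Type u} [Ring R] [IsNoetherianRing R]
    (h : FiniteLeftGlobalDim Rᵐᵒᵖ) : FiniteLeftGlobalDim R := by
  obtain ⟨n, hn⟩ := h.exists_succ
  exact ⟨n + 1, LeftGlobalDimLT.of_finite fun M _ _ _ =>
    CharacterModule.projDimLT_of_hasInjectiveDimensionLT M (hn.hasInjectiveDimensionLT _)⟩

/-- A right Noetherian ring of finite left global dimension has finite right global dimension. -/
theorem FiniteLeftGlobalDim.op {R : Type u} [Ring R] [IsNoetherianRing Rᵐᵒᵖ]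
    (h : FiniteLeftGlobalDim R) : FiniteLeftGlobalDim Rᵐᵒᵖ :=
  .of_op (h.of_ringEquiv (RingEquiv.opOp R))

end LeftRight

/-! ### Global dimension along a stratifying idempotent -/

section Stratification

/-- M is the direct sum of the left ideals R ε_y, with m y in the role of ε_y. Right multiplication
of the coordinates by ε kills the relations by `hind`, so it descends to a section of the free
cover. That ε_y is idempotent is not assumed; it follows from `hind` applied to the relation (1 -
ε_y) m y = 0. -/
theorem Module.Projective.of_family {R : Type*} [Ring R] {M Y : Type*} [AddCommGroup M]
    [Module R M] (m : Y → M) (ε : Y → R) (hε : ∀ y, ε y • m y = m y)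
    (hspan : ∀ z, ∃ r : Y →₀ R, Finsupp.linearCombination R m r = z)
    (hind : ∀ r : Y →₀ R, Finsupp.linearCombination R m r = 0 → ∀ y, r y * ε y = 0) :
    Module.Projective R M := by
  let Φ := Finsupp.linearCombination R m
  let π : (Y →₀ R) →ₗ[R] (Y →₀ R) :=
    Finsupp.linearCombination R fun y => Finsupp.single y (ε y)
  have hπ : ∀ y r, π (Finsupp.single y r) = Finsupp.single y (r * ε y) := fun y r => by
    rw [Finsupp.linearCombination_single, Finsupp.smul_single, smul_eq_mul]
  have hπ' : ∀ r y, π r y = r y * ε y := by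
    intro r y
    induction r using Finsupp.induction_linear with
    | zero => simp
    | add f g hf hg => rw [map_add, Finsupp.add_apply, hf, hg, Finsupp.add_apply, add_mul]
    | single a b =>
      classical
      rw [hπ, Finsupp.single_apply, Finsupp.single_apply]
      split_ifs with h
      · rw [h]
      · rw [zero_mul]
  have hΦπ : ∀ r, Φ (π r) = Φ r := by
    intro r
    induction r using Finsupp.induction_linear with
    | zero => simp
    | add f g hf hg => rw [map_add, map_add, hf, hg, map_add]
    | single a b =>
      rw [hπ, Finsupp.linearCombination_single, Finsupp.linearCombination_single, mul_smul, hε]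
  have hker : LinearMap.ker Φ ≤ LinearMap.ker π := fun r hr => by
    ext y
    rw [hπ', hind r hr y, Finsupp.zero_apply]
  have hsurj : Function.Surjective Φ := hspan
  let s : M →ₗ[R] (Y →₀ R) :=
    (LinearMap.ker Φ).liftQ π hker ∘ₗ (Φ.quotKerEquivOfSurjective hsurj).symm.toLinearMap
  have hs : ∀ r, s (Φ r) = π r := fun r => by
    have : (Φ.quotKerEquivOfSurjective hsurj).symm (Φ r) = Submodule.Quotient.mk r := by
      rw [LinearEquiv.symm_apply_eq]
      rfl
    simp [s, this]
  refine Module.Projective.of_split s Φ ?_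
  ext z
  obtain ⟨r, rfl⟩ := hsurj z
  simp only [LinearMap.comp_apply, LinearMap.id_apply, hs, hΦπ]

instance Module.Projective.finsupp {R J M : Type*} [Ring R] [AddCommGroup M] [Module R M]
    [Module.Projective R M] : Module.Projective R (J →₀ M) := by
  classical
  exact Module.Projective.of_equiv (finsuppLequivDFinsupp R (ι := J) (M := M)).symm

variable {R S B : Type u} [Ring R] [Ring S] [Ring B]

/-- Splits the four-term exact sequence ker → M → N → coker at the image of g. -/
theorem ProjDimLT.of_ker_of_range {M N : Type u} [AddCommGroup M] [Module R M]
    [AddCommGroup N] [Module R N] (g : M →ₗ[R] N) {n : ℕ} (hK : ProjDimLT R (LinearMap.ker g) n)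
    (hM : ProjDimLT R M (n + 1)) (hC : ProjDimLT R (N ⧸ LinearMap.range g) (n + 1)) :
    ProjDimLT R N (n + 1) := by
  refine ProjDimLT.of_quotient _ ?_ hC
  refine ProjDimLT.right (f := (LinearMap.ker g).subtype) (g := g.rangeRestrict) ?_
    (LinearMap.ker g).injective_subtype g.surjective_rangeRestrict hK hM
  rw [LinearMap.exact_iff, LinearMap.ker_rangeRestrict, Submodule.range_subtype]

/-- A direct sum of copies of 0 → ker g → M → N → 0 is a projective resolution of length 1. Used for
N a quotient ring of R, to resolve its free modules over R. -/
theorem ProjDimLT.finsupp_of_surjective {M N : Type u} [AddCommGroup M] [Module R M]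
    [AddCommGroup N] [Module R N] (g : M →ₗ[R] N) (hg : Function.Surjective g)
    [Module.Projective R M] [Module.Projective R (LinearMap.ker g)] (J : Type u) :
    ProjDimLT R (J →₀ N) 2 := by
  refine ProjDimLT.right (f := Finsupp.mapRange.linearMap (α := J) (LinearMap.ker g).subtype)
    (g := Finsupp.mapRange.linearMap (α := J) g) ?_ ?_ ?_
    (ProjDimLT.of_projective one_pos) (ProjDimLT.of_projective two_pos)
  · rw [LinearMap.exact_iff, Finsupp.ker_mapRange, Finsupp.range_mapRange_linearMap]
    · rw [Submodule.range_subtype]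
    · exact LinearMap.ker_eq_bot.2 (LinearMap.ker g).injective_subtype
  · exact Finsupp.mapRange_injective _ (map_zero _) (LinearMap.ker g).injective_subtype
  · exact Finsupp.mapRange_surjective _ (map_zero _) hg

/-- Change of rings: free S-modules have projective dimension at most 1 over R because the kernel of
f is projective. Projective S-modules are retracts of them, and each further S-syzygy costs one
more. -/
theorem ProjDimLT.restrictScalars (f : R →+* S) (hf : Function.Surjective f)
    [Module.Projective R (RingHom.ker f)] {n : ℕ} (W : Type u) [AddCommGroup W] [Module S W]
    [Module R W] (hW : ∀ (r : R) (w : W), f r • w = r • w) (h : ProjDimLT S W (n + 1)) :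
    ProjDimLT R W (n + 2) := by
  let _ : Module R S := Module.compHom S f
  let g : R →ₗ[R] S := LinearMap.toSpanSingleton R S 1
  have hgf : ∀ r, g r = f r := fun r => mul_one (f r)
  have hg : Function.Surjective g := fun s => (hf s).imp fun r hr => (hgf r).trans hr
  have hk : LinearMap.ker g = RingHom.ker f := by
    ext r
    rw [LinearMap.mem_ker, RingHom.mem_ker, hgf]
  have : Module.Projective R (LinearMap.ker g) :=
    Module.Projective.of_equiv (LinearEquiv.ofEq _ _ hk.symm)
  have htower (W : Type u) [AddCommGroup W] [Module S W] [Module R W]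
      (hW : ∀ (r : R) (w : W), f r • w = r • w) : IsScalarTower R S W :=
    ⟨fun r s w => by
      rw [← hW]
      exact mul_smul (f r) s w⟩
  have := htower W hW
  have htower' := htower (W →₀ S) fun r w => rfl
  have hfree : ProjDimLT R (W →₀ S) 2 := ProjDimLT.finsupp_of_surjective g hg W
  induction n generalizing W with
  | zero =>
    have := h.projective
    obtain ⟨s, hs⟩ := Module.projective_def'.1 this
    exact ProjDimLT.of_retract (s.restrictScalars R)
      ((Finsupp.linearCombination S id).restrictScalars R)
      (fun x => LinearMap.congr_fun hs x) hfree
  | succ n ih =>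
    let p : (W →₀ S) →ₗ[S] W := Finsupp.linearCombination S id
    have hp : Function.Surjective p := Finsupp.linearCombination_id_surjective S W
    have hK := ProjDimLT.ker p hp (n := n + 1) (ProjDimLT.of_projective n.succ_pos) h
    have hK' : ProjDimLT R (LinearMap.ker p) (n + 2) :=
      ih (LinearMap.ker p) (fun r w => Subtype.ext rfl) hK (htower _ fun r w => Subtype.ext rfl)
        (htower _ fun r w => rfl) (ProjDimLT.finsupp_of_surjective g hg _)
    exact ProjDimLT.of_ker (p.restrictScalars R) hp hK' (hfree.mono (by omega))

/-- A module that is annihilated by the kernel of a surjective ring homomorphism `R → S` has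
small projective dimension over `R` if `S` has small global dimension. -/
theorem ProjDimLT.of_annihilated (f : R →+* S) (hf : Function.Surjective f)
    [Module.Projective R (RingHom.ker f)] {n : ℕ} (hS : LeftGlobalDimLT S (n + 1)) (W : Type u)
    [AddCommGroup W] [Module R W] (hW : ∀ r, f r = 0 → ∀ w : W, r • w = 0) :
    ProjDimLT R W (n + 2) := by
  -- A set-theoretic section suffices to let S act, since elements with the same image under f act
  -- equally on W.
  let s := Function.surjInv hf
  have hs : ∀ x, f (s x) = x := Function.surjInv_eq hf
  have key : ∀ (a b : R) (w : W), f a = f b → a • w = b • w := fun a b w hab => by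
    rw [← sub_eq_zero, ← sub_smul]
    exact hW _ (by rw [map_sub, hab, sub_self]) w
  let _ : Module S W :=
    { smul := fun x w => s x • w
      one_smul := fun w => (key _ _ w (by rw [hs, map_one])).trans (one_smul R w)
      mul_smul := fun x y w =>
        (key _ _ w (by rw [hs, map_mul, hs, hs])).trans (mul_smul (s x) (s y) w)
      smul_zero := fun x => smul_zero (s x)
      smul_add := fun x v w => smul_add (s x) v w
      add_smul := fun x y w =>
        (key _ _ w (by rw [hs, map_add, hs, hs])).trans (add_smul (s x) (s y) w)
      zero_smul := fun w => (key _ _ w (by rw [hs, map_zero])).trans (zero_smul R w) }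
  exact ProjDimLT.restrictScalars f hf W (fun r w => key _ _ w (hs (f r))) (hS W)

/-- The subgroup `e V` of a module `V`, for `e = ι 1`. -/
def cornerSubgroup (ι : B →ₙ+* R) (V : Type*) [AddCommGroup V] [Module R V] : AddSubgroup V where
  carrier := {v | ι 1 • v = v}
  add_mem' {v w} hv hw := by
    change ι 1 • (v + w) = v + w
    rw [smul_add, hv, hw]
  zero_mem' := smul_zero _
  neg_mem' {v} hv := by
    change ι 1 • (-v) = -v
    rw [smul_neg, hv]

section Corner

variable (ι : B →ₙ+* R) {V W : Type*} [AddCommGroup V] [Module R V] [AddCommGroup W] [Module R W]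

theorem corner_smul_mem (b : B) (v : V) : ι b • v ∈ cornerSubgroup ι V := by
  change ι 1 • ι b • v = ι b • v
  rw [smul_smul, ← map_mul, one_mul]

instance : Module B (cornerSubgroup ι V) where
  smul b v := ⟨ι b • (v : V), corner_smul_mem ι b (v : V)⟩
  one_smul v := Subtype.ext v.2
  mul_smul a b v := Subtype.ext (by
    change ι (a * b) • (v : V) = ι a • ι b • (v : V)
    rw [map_mul, mul_smul])
  smul_zero b := Subtype.ext (show ι b • (0 : V) = 0 from smul_zero _)
  smul_add b v w := Subtype.ext
    (show ι b • ((v : V) + w) = ι b • (v : V) + ι b • (w : V) from smul_add _ _ _)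
  add_smul a b v := Subtype.ext (by
    change ι (a + b) • (v : V) = ι a • (v : V) + ι b • (v : V)
    rw [map_add, add_smul])
  zero_smul v := Subtype.ext (by
    change ι 0 • (v : V) = 0
    rw [map_zero, zero_smul])

theorem corner_coe_smul (b : B) (v : cornerSubgroup ι V) : ((b • v : cornerSubgroup ι V) : V) =
    ι b • (v : V) := rfl

/-- The restriction of a homomorphism `V → W` to `e V → e W`. -/
def cornerMap (g : V →ₗ[R] W) : cornerSubgroup ι V →ₗ[B] cornerSubgroup ι W where
  toFun v := ⟨g v, by
    change ι 1 • g v = g v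
    rw [← map_smul, v.2]⟩
  map_add' v w := Subtype.ext (map_add g (v : V) w)
  map_smul' b v := Subtype.ext (map_smul g (ι b) (v : V))

theorem cornerMap_surjective (g : V →ₗ[R] W) (hg : Function.Surjective g) :
    Function.Surjective (cornerMap ι g) := by
  rintro ⟨w, hw⟩
  obtain ⟨v, rfl⟩ := hg w
  exact ⟨⟨ι 1 • v, corner_smul_mem ι 1 v⟩, Subtype.ext ((map_smul g _ _).trans hw)⟩

/-- For e = ι 1, the corner e R^(J) is (eR)^(J). -/
theorem projective_corner_finsupp [Module.Projective B (cornerSubgroup ι R)] (J : Type*) :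
    Module.Projective B (cornerSubgroup ι (J →₀ R)) := by
  have he : ∀ r : R, ι 1 • r ∈ cornerSubgroup ι R := corner_smul_mem ι 1
  let π : R →+ cornerSubgroup ι R := AddMonoidHom.mk' (fun r => ⟨ι 1 • r, he r⟩)
    fun r s => Subtype.ext (smul_add _ r s)
  let i : cornerSubgroup ι (J →₀ R) →ₗ[B] (J →₀ cornerSubgroup ι R) :=
    { toFun := fun g => Finsupp.mapRange π (map_zero π) g.1
      map_add' := fun g h => Finsupp.mapRange_add (map_add π) g.1 h.1
      map_smul' := fun b g => by
        ext j
        change ι 1 • ι b • g.1 j = ι b • ι 1 • g.1 j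
        rw [smul_smul, smul_smul, ← map_mul, ← map_mul, one_mul, mul_one] }
  let s : (J →₀ cornerSubgroup ι R) →ₗ[B] cornerSubgroup ι (J →₀ R) :=
    { toFun := fun h => ⟨Finsupp.mapRange (Subtype.val) rfl h, by
        ext j
        exact (h j).2⟩
      map_add' := fun g h => Subtype.ext (Finsupp.mapRange_add (hf := rfl) (fun _ _ => rfl) g h)
      map_smul' := fun b g => by
        ext j
        rfl }
  refine Module.Projective.of_split i s ?_
  ext g j
  exact DFunLike.congr_fun g.2 j

/-- Q plays the role of Re ⊗_B eV, with e = ι 1, and g that of the multiplication map to V; after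
multiplication by e this map becomes an isomorphism, so e kills its kernel and cokernel. Concretely,
σ presents eV as the image of an idempotent matrix over B. Its entries are read in R through ι, and
Q is the image of the resulting idempotent endomorphism ψ of the free module, which avoids tensor
products. -/
theorem exists_projective_of_projective_corner (hι : ∀ r, ∃ b, ι b = ι 1 * r * ι 1)
    (V : Type u) [AddCommGroup V] [Module R V] [hV : Module.Projective B (cornerSubgroup ι V)] :
    ∃ (Q : Type u) (_ : AddCommGroup Q) (_ : Module R Q) (g : Q →ₗ[R] V), Module.Projective R Q ∧
      (∀ q, g q = 0 → ι 1 • q = 0) ∧ ∀ v, ∃ q, g q = ι 1 • v := by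
  obtain ⟨σ, hσ⟩ := Module.projective_def'.1 hV
  have hσ' : ∀ x, Finsupp.linearCombination B id (σ x) = x := fun x => LinearMap.congr_fun hσ x
  let P := cornerSubgroup ι V
  let J : (P →₀ B) →+ (P →₀ R) := Finsupp.mapRange.addMonoidHom ι.toAddMonoidHom
  have hJ : ∀ (b : B) (β : P →₀ B), J (b • β) = ι b • J β := fun b β => by
    ext x
    exact map_mul ι b (β x)
  let ψ : (P →₀ R) →ₗ[R] (P →₀ R) := Finsupp.linearCombination R fun x => J (σ x)
  let φ : (P →₀ R) →ₗ[R] V := Finsupp.linearCombination R fun x : P => (x : V)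
  have hJs : ∀ x b, J (Finsupp.single x b) = Finsupp.single x (ι b) := fun x b =>
    Finsupp.mapRange_single (hf := map_zero ι)
  have hψJ : ∀ β : P →₀ B, ψ (J β) = J (σ (Finsupp.linearCombination B id β)) := by
    intro β
    induction β using Finsupp.induction_linear with
    | zero => simp
    | add f g hf hg => simp only [map_add, hf, hg]
    | single x b =>
      rw [hJs, Finsupp.linearCombination_single, Finsupp.linearCombination_single, map_smul, hJ]
      rfl
  have hφJ : ∀ β : P →₀ B, φ (J β) = (Finsupp.linearCombination B id β : P) := by
    intro β
    induction β using Finsupp.induction_linear with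
    | zero => simp
    | add f g hf hg => simp only [map_add, hf, hg, AddSubgroup.coe_add]
    | single x b =>
      rw [hJs, Finsupp.linearCombination_single, Finsupp.linearCombination_single]
      rfl
  have hψψ : ∀ q, ψ (ψ q) = ψ q := by
    intro q
    induction q using Finsupp.induction_linear with
    | zero => simp
    | add f g hf hg => simp only [map_add, hf, hg]
    | single x r => rw [Finsupp.linearCombination_single, map_smul, hψJ, hσ']
  have hJe : ∀ β : P →₀ B, ι 1 • J β = J β := fun β => by rw [← hJ, one_smul]
  have hcorner : ∀ q, ∃ p : P, ι 1 • ψ q = J (σ p) ∧ ι 1 • φ q = p := by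
    intro q
    induction q using Finsupp.induction_linear with
    | zero => exact ⟨0, by simp, by simp⟩
    | add f g hf hg =>
      obtain ⟨p, hp, hp'⟩ := hf
      obtain ⟨r, hr, hr'⟩ := hg
      exact ⟨p + r, by simp only [map_add, smul_add, hp, hr],
        by simp only [map_add, smul_add, hp', hr', AddSubgroup.coe_add]⟩
    | single x r =>
      obtain ⟨b, hb⟩ := hι r
      refine ⟨b • x, ?_, ?_⟩
      · rw [Finsupp.linearCombination_single, map_smul, hJ, hb, mul_smul, mul_smul, hJe]
      · rw [Finsupp.linearCombination_single, corner_coe_smul, hb, mul_smul, mul_smul, x.2]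
  let Q := LinearMap.range ψ
  have hψQ : ∀ q : Q, ψ q = q := by
    rintro ⟨_, q, rfl⟩
    exact hψψ q
  have : Module.Projective R Q := by
    refine Module.Projective.of_split Q.subtype ψ.rangeRestrict ?_
    ext1 q
    exact Subtype.ext (hψQ q)
  let g : Q →ₗ[R] V := φ ∘ₗ Q.subtype
  refine ⟨Q, inferInstance, inferInstance, g, this, fun q hq => ?_, fun v => ?_⟩
  · obtain ⟨p, hp, hp'⟩ := hcorner q.1
    have hq0 : φ q.1 = 0 := hq
    rw [hq0, smul_zero] at hp'
    rw [hψQ, show p = 0 from Subtype.ext hp'.symm, map_zero, map_zero] at hp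
    exact Subtype.ext hp
  · let x : P := ⟨ι 1 • v, corner_smul_mem ι 1 v⟩
    refine ⟨⟨ψ (Finsupp.single x 1), LinearMap.mem_range_self _ _⟩, ?_⟩
    change φ (ψ (Finsupp.single x 1)) = _
    rw [Finsupp.linearCombination_single, one_smul, hφJ, hσ']

/-- V differs from the projective module Q only by a kernel and a cokernel killed by e = ι 1, to
which `hn` applies. -/
theorem ProjDimLT.of_projective_corner (hι : ∀ r, ∃ b, ι b = ι 1 * r * ι 1)
    {n : ℕ} (hn : ∀ (W : Type u) [AddCommGroup W] [Module R W], (∀ w : W, ι 1 • w = 0) →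
      ProjDimLT R W n) (V : Type u) [AddCommGroup V] [Module R V]
    [hV : Module.Projective B (cornerSubgroup ι V)] : ProjDimLT R V (n + 1) := by
  obtain ⟨Q, _, _, g, _, hker, hrange⟩ := exists_projective_of_projective_corner ι hι V
  refine ProjDimLT.of_ker_of_range g (hn _ fun q => Subtype.ext (hker q.1 q.2))
    (ProjDimLT.of_projective n.succ_pos) ((hn _ fun w => ?_).mono n.le_succ)
  obtain ⟨v, rfl⟩ := Submodule.Quotient.mk_surjective _ w
  rw [← Submodule.Quotient.mk_smul, Submodule.Quotient.mk_eq_zero]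
  exact hrange v

/-- The functor V ↦ eV is exact and takes free modules to projective ones, so syzygies of V give
syzygies of eV until the latter is projective. -/
theorem ProjDimLT.of_corner (hι : ∀ r, ∃ b, ι b = ι 1 * r * ι 1)
    [Module.Projective B (cornerSubgroup ι R)]
    {n : ℕ} (hn : ∀ (W : Type u) [AddCommGroup W] [Module R W], (∀ w : W, ι 1 • w = 0) →
      ProjDimLT R W n) {m : ℕ} (V : Type u) [AddCommGroup V] [Module R V]
    (hV : ProjDimLT B (cornerSubgroup ι V) (m + 1)) : ProjDimLT R V (n + m + 1) := by
  induction m generalizing V with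
  | zero =>
    have := hV.projective
    exact ProjDimLT.of_projective_corner ι hι hn V
  | succ m ih =>
    let p : (V →₀ R) →ₗ[R] V := Finsupp.linearCombination R id
    have hp : Function.Surjective p := Finsupp.linearCombination_id_surjective R V
    have := projective_corner_finsupp ι V
    have hK := ProjDimLT.ker (cornerMap ι p) (cornerMap_surjective ι p hp)
      (ProjDimLT.of_projective m.succ_pos) hV
    let E : LinearMap.ker (cornerMap ι p) ≃ₗ[B] cornerSubgroup ι (LinearMap.ker p) :=
      { toFun := fun v => ⟨⟨v.1.1, congrArg Subtype.val v.2⟩, Subtype.ext v.1.2⟩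
        invFun := fun v => ⟨⟨v.1.1, congrArg Subtype.val v.2⟩, Subtype.ext v.1.2⟩
        map_add' := fun _ _ => rfl
        map_smul' := fun _ _ => rfl
        left_inv := fun _ => rfl
        right_inv := fun _ => rfl }
    exact ProjDimLT.of_ker p hp (ih _ (hK.of_linearEquiv E)) (ProjDimLT.of_projective (by omega))

end Corner

/-- Ring homomorphisms `B ≅ e R e ⊆ R → S`, with `e = ι 1` and `R → S` surjective with kernel
the left module with generators `m y` (`y : Y`) subject only to the relations
`ι (ε y) * m y = m y`. -/
structure IsLeftStratifying (f : R →+* S) (ι : B →ₙ+* R) {Y : Type*} (ε : Y → B) (m : Y → R) :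
    Prop where
  surjective : Function.Surjective f
  injective : Function.Injective ι
  exists_eq : ∀ r, ∃ b, ι b = ι 1 * r * ι 1
  map_idem : f (ι 1) = 0
  idem_mul : ∀ y, ι (ε y) * m y = m y
  exists_linearCombination : ∀ z, f z = 0 → ∃ r : Y →₀ R, Finsupp.linearCombination R m r = z
  mul_idem_eq_zero : ∀ r : Y →₀ R, Finsupp.linearCombination R m r = 0 → ∀ y, r y * ι (ε y) = 0

namespace IsLeftStratifying

variable {f : R →+* S} {ι : B →ₙ+* R} {Y : Type*} {ε : Y → B} {m : Y → R}
  (h : IsLeftStratifying f ι ε m)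

include h

theorem one_mul_m (y : Y) : ι 1 * m y = m y := by
  rw [← h.idem_mul, ← mul_assoc, ← map_mul, one_mul]

theorem map_m (y : Y) : f (m y) = 0 := by
  rw [← h.one_mul_m, map_mul, h.map_idem, zero_mul]

/-- The structure presents the kernel of f as a direct sum of left ideals R ι(ε y). -/
theorem projective_ker : Module.Projective R (RingHom.ker f) := by
  have hval : ∀ r : Y →₀ R, ((Finsupp.linearCombination R
      (fun y => (⟨m y, h.map_m y⟩ : RingHom.ker f)) r : RingHom.ker f) : R) =
      Finsupp.linearCombination R m r := fun r => by
    simp [Finsupp.linearCombination_apply, Finsupp.sum]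
  refine Module.Projective.of_family (fun y => (⟨m y, h.map_m y⟩ : RingHom.ker f))
    (fun y => ι (ε y)) (fun y => Subtype.ext (h.idem_mul y)) (fun z => ?_) fun r hr => ?_
  · obtain ⟨r, hr⟩ := h.exists_linearCombination z.1 z.2
    exact ⟨r, Subtype.ext ((hval r).trans hr)⟩
  · exact h.mul_idem_eq_zero r (by rw [← hval, hr]; rfl)

/-- With e = ι 1, eR lies in the kernel of f because f e = 0. Since e m y = m y, the coefficients of
an element of eR may be replaced by elements of eRe, so eR has the same presentation over B. -/
theorem projective_corner : Module.Projective B (cornerSubgroup ι R) := by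
  have hval : ∀ r : Y →₀ B, ((Finsupp.linearCombination B
      (fun y => (⟨m y, h.one_mul_m y⟩ : cornerSubgroup ι R)) r : cornerSubgroup ι R) : R) =
      Finsupp.linearCombination R m (Finsupp.mapRange ι (map_zero ι) r) := fun r => by
    induction r using Finsupp.induction_linear with
    | zero => simp
    | add f g hf hg =>
      rw [map_add, Finsupp.mapRange_add (map_add ι), map_add, AddSubgroup.coe_add, hf, hg]
    | single y b =>
      rw [Finsupp.mapRange_single, Finsupp.linearCombination_single,
        Finsupp.linearCombination_single]
      rfl
  refine Module.Projective.of_family (fun y => (⟨m y, h.one_mul_m y⟩ : cornerSubgroup ι R)) ε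
    (fun y => Subtype.ext (h.idem_mul y)) (fun z => ?_) fun r hr y => ?_
  · have hz : ι 1 * z.1 = z.1 := z.2
    obtain ⟨r, hr⟩ := h.exists_linearCombination z.1 (by
      rw [← hz, map_mul, h.map_idem, zero_mul])
    choose κ hκ using h.exists_eq
    have hκ0 : κ 0 = 0 := h.injective (by rw [hκ, mul_zero, zero_mul, map_zero])
    refine ⟨Finsupp.mapRange κ hκ0 r, Subtype.ext ?_⟩
    rw [hval, ← hz, ← hr, ← smul_eq_mul, ← map_smul, Finsupp.linearCombination_apply,
      Finsupp.linearCombination_apply, Finsupp.sum_mapRange_index (by simp),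
      Finsupp.sum_mapRange_index (by simp),
      Finsupp.sum_smul_index (by simp)]
    refine Finsupp.sum_congr fun y _ => ?_
    rw [hκ, smul_eq_mul, smul_eq_mul, mul_assoc, h.one_mul_m]
  · have := h.mul_idem_eq_zero _ ((hval r).symm.trans (by rw [hr]; rfl)) y
    rw [Finsupp.mapRange_apply, ← map_mul] at this
    exact h.injective (this.trans (map_zero ι).symm)

/-- The stratification bound for global dimensions. -/
theorem finiteLeftGlobalDim (hS : FiniteLeftGlobalDim S) (hB : FiniteLeftGlobalDim B) :
    FiniteLeftGlobalDim R := by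
  obtain ⟨s, hs⟩ := hS.exists_succ
  obtain ⟨b, hb⟩ := hB.exists_succ
  have := h.projective_ker
  have := h.projective_corner
  -- Modules killed by e = ι 1 are killed by the kernel of f, generated by m y = e m y, so their
  -- projective dimension is < s + 2. The corner eV contributes b + 1.
  refine ⟨s + 2 + b + 1, fun V _ _ => ProjDimLT.of_corner ι h.exists_eq
    (fun W _ _ hW => ProjDimLT.of_annihilated f h.surjective hs W fun r hr w => ?_) V (hb _)⟩
  obtain ⟨c, rfl⟩ := h.exists_linearCombination r hr
  rw [Finsupp.linearCombination_apply, Finsupp.sum, Finset.sum_smul]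
  refine Finset.sum_eq_zero fun y _ => ?_
  rw [← h.one_mul_m, smul_eq_mul, mul_smul, mul_smul, hW, smul_zero]

end IsLeftStratifying

end Stratification

/-! ### Homogeneous components -/

section Projections

variable {M : Type*} [AddCommGroup M]

/-- The projection to the component of degree `d`. -/
def grProj (ℳ : ℤ → AddSubgroup M) [DirectSum.Decomposition ℳ] (d : ℤ) : M →+ M where
  toFun x := DirectSum.decompose ℳ x d
  map_zero' := by simp
  map_add' := by simp

section

variable (ℳ : ℤ → AddSubgroup M) [DirectSum.Decomposition ℳ]

theorem grProj_mem (d : ℤ) (x : M) : grProj ℳ d x ∈ ℳ d := SetLike.coe_mem _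

theorem grProj_same {d : ℤ} {x : M} (hx : x ∈ ℳ d) : grProj ℳ d x = x :=
  DirectSum.decompose_of_mem_same ℳ hx

theorem grProj_of_ne {d d' : ℤ} {x : M} (hx : x ∈ ℳ d) (h : d ≠ d') : grProj ℳ d' x = 0 :=
  DirectSum.decompose_of_mem_ne ℳ hx h

theorem gr_induction {p : M → Prop} (zero : p 0) (hom : ∀ d, ∀ x ∈ ℳ d, p x)
    (add : ∀ x y, p x → p y → p (x + y)) (x : M) : p x :=
  DirectSum.Decomposition.inductionOn ℳ zero (fun {i} m => hom i m m.2) add x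

theorem exists_sum_grProj (x : M) : ∃ s : Finset ℤ, x = ∑ d ∈ s, grProj ℳ d x := by
  classical
  exact ⟨_, (DirectSum.sum_support_decompose ℳ x).symm⟩

theorem eq_zero_of_grProj {x : M} (h : ∀ d, grProj ℳ d x = 0) : x = 0 := by
  obtain ⟨s, hs⟩ := exists_sum_grProj ℳ x
  rw [hs]
  exact Finset.sum_eq_zero fun d _ => h d

end

/-- A family of subgroups with a family of projections gives a decomposition. -/
theorem isInternal_of_proj {ℳ : ℤ → AddSubgroup M} (p : ℤ → M →+ M)
    (hsame : ∀ d, ∀ x ∈ ℳ d, p d x = x) (hne : ∀ d d', d ≠ d' → ∀ x ∈ ℳ d, p d' x = 0)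
    (htop : ∀ x, x ∈ ⨆ d, ℳ d) : DirectSum.IsInternal ℳ := by
  constructor
  · rw [injective_iff_map_eq_zero]
    intro x hx
    have key : ∀ (y : DirectSum ℤ fun d => ℳ d) d,
        p d (DirectSum.coeAddMonoidHom ℳ y) = y d := by
      intro y d
      induction y using DirectSum.induction_on with
      | zero => simp
      | of i z =>
        rw [DirectSum.coeAddMonoidHom_of]
        by_cases h : i = d
        · subst h
          rw [hsame _ _ z.2, DirectSum.of_eq_same]
        · rw [hne _ _ h _ z.2, DirectSum.of_eq_of_ne _ _ _ (Ne.symm h)]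
          rfl
      | add y z hy hz => rw [map_add, map_add, hy, hz, DirectSum.add_apply, AddSubgroup.coe_add]
    ext d
    rw [← key, hx, map_zero]
    rfl
  · intro x
    refine AddSubgroup.iSup_induction ℳ (C := fun x =>
      ∃ y, DirectSum.coeAddMonoidHom ℳ y = x) (htop x) (fun d x hx => ?_) ⟨0, map_zero _⟩ ?_
    · exact ⟨DirectSum.of (fun d => ℳ d) d ⟨x, hx⟩, DirectSum.coeAddMonoidHom_of _ _ _⟩
    · rintro _ _ ⟨y, rfl⟩ ⟨z, rfl⟩
      exact ⟨y + z, map_add _ _ _⟩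

end Projections

/-! ### Graded and ungraded projective dimension -/

section GradedRings

theorem grProj_smul {R : Type u} [Ring R] (𝒜 : ℤ → AddSubgroup R) {M : Type*} [AddCommGroup M]
    [Module R M] (ℳ : ℤ → AddSubgroup M) [DirectSum.Decomposition ℳ] [SetLike.GradedSMul 𝒜 ℳ] {c : ℤ} {a : R} (ha : a ∈ 𝒜 c) (d : ℤ)
    (x : M) : grProj ℳ (c + d) (a • x) = a • grProj ℳ d x := by
  have hsmul : ∀ n, ∀ y ∈ ℳ n, a • y ∈ ℳ (c + n) := fun n y hy =>
    SetLike.GradedSMul.smul_mem ha hy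
  induction x using gr_induction ℳ with
  | zero => simp
  | hom n x hx =>
    by_cases h : n = d
    · subst h
      rw [grProj_same ℳ (hsmul _ _ hx), grProj_same ℳ hx]
    · rw [grProj_of_ne ℳ (hsmul _ _ hx) (by omega), grProj_of_ne ℳ hx h, smul_zero]
  | add x y hx hy => rw [smul_add, map_add, map_add, smul_add, hx, hy]

variable {R : Type u} [Ring R] (𝒜 : ℤ → AddSubgroup R) [GradedRing 𝒜]

namespace GrMod

variable {𝒜}

/-- The zero graded module. -/
noncomputable def zero (𝒜 : ℤ → AddSubgroup R) : GrMod 𝒜 where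
  carrier := PUnit.{u + 1}
  gr _ := ⊥
  decomposition := (isInternal_of_proj 0 (fun _ _ _ => rfl) (fun _ _ _ _ _ => rfl)
    fun _ => zero_mem _).chooseDecomposition
  gradedSMul := ⟨fun {_ _ _ _} _ _ => rfl⟩

instance : Subsingleton (zero 𝒜) := inferInstanceAs (Subsingleton PUnit)

/-- The kernel of a homomorphism of graded modules. -/
noncomputable def ker {V W : GrMod 𝒜} (g : Hom V W) : GrMod 𝒜 where
  carrier := LinearMap.ker g.toLinearMap
  gr d := (V.gr d).comap (LinearMap.ker g.toLinearMap).subtype.toAddMonoidHom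
  decomposition := by
    have hp : ∀ d x, g (grProj V.gr d x) = grProj W.gr d (g x) := fun d x => by
      induction x using gr_induction V.gr with
      | zero => simp
      | hom n x hx =>
        by_cases h : n = d
        · subst h
          rw [grProj_same _ hx, grProj_same _ (g.map_gr _ _ hx)]
        · rw [grProj_of_ne _ hx h, grProj_of_ne _ (g.map_gr _ _ hx) h, map_zero]
      | add x y hx hy => simp only [map_add, hx, hy]
    let p (d : ℤ) : LinearMap.ker g.toLinearMap →+ LinearMap.ker g.toLinearMap :=
      AddMonoidHom.mk' (fun x => ⟨grProj V.gr d x, by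
        rw [LinearMap.mem_ker]
        exact (hp d x).trans (by rw [show g x.1 = 0 from x.2, map_zero])⟩)
        fun x y => Subtype.ext (map_add _ _ _)
    refine (isInternal_of_proj p (fun d x hx => Subtype.ext (grProj_same _ hx))
      (fun d d' h x hx => Subtype.ext (grProj_of_ne _ hx h)) fun x => ?_).chooseDecomposition
    obtain ⟨s, hs⟩ := exists_sum_grProj V.gr x.1
    have : x = ∑ d ∈ s, p d x := Subtype.ext (hs.trans (by
      rw [AddSubmonoidClass.coe_finsetSum]
      rfl))
    rw [this]
    exact sum_mem fun d _ => AddSubgroup.mem_iSup_of_mem d (grProj_mem V.gr d x.1)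
  gradedSMul := ⟨fun {i j a x} ha hx =>
    (SetLike.GradedSMul.smul_mem ha hx : a • (x : V) ∈ V.gr (i +ᵥ j))⟩

/-- The inclusion of the kernel. -/
def kerι {V W : GrMod 𝒜} (g : Hom V W) : Hom (ker g) V where
  toLinearMap := (LinearMap.ker g.toLinearMap).subtype
  map_gr _ _ hx := hx

/-- The composition of homomorphisms of graded modules. -/
def Hom.comp {U V W : GrMod 𝒜} (g : Hom V W) (f : Hom U V) : Hom U W where
  toLinearMap := g.toLinearMap ∘ₗ f.toLinearMap
  map_gr d x hx := g.map_gr d _ (f.map_gr d x hx)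

/-- The zero homomorphism. -/
def zeroHom (V W : GrMod 𝒜) : Hom V W where
  toLinearMap := 0
  map_gr d _ _ := zero_mem (W.gr d)

/-- The identity homomorphism. -/
def idHom (V : GrMod 𝒜) : Hom V V where
  toLinearMap := LinearMap.id
  map_gr _ _ hx := hx

/-- The degree-preserving part of an ungraded lift, x ↦ (h x)_d for x of degree d, is again linear
and lifts f because g and f preserve degrees. -/
theorem IsProjective.of_projective (P : GrMod 𝒜) [hP : Module.Projective R P] :
    P.IsProjective := by
  intro V W g f hg
  obtain ⟨h, hh⟩ := Module.projective_lifting_property g.toLinearMap f.toLinearMap hg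
  let h₀ : P →+ V := (DirectSum.toAddMonoid fun d =>
    ((grProj V.gr d).comp h.toAddMonoidHom).comp (P.gr d).subtype).comp
      (DirectSum.decomposeAddEquiv P.gr).toAddMonoidHom
  have h₀_apply : ∀ d, ∀ x ∈ P.gr d, h₀ x = grProj V.gr d (h x) := by
    intro d x hx
    change DirectSum.toAddMonoid _ (DirectSum.decompose P.gr x) = _
    rw [DirectSum.decompose_of_mem P.gr hx, DirectSum.toAddMonoid_of]
    rfl
  have h₀_smul : ∀ (a : R) (x : P), h₀ (a • x) = a • h₀ x := by
    intro a x
    induction a using gr_induction 𝒜 with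
    | zero => simp
    | add a b ha hb => simp only [add_smul, map_add, ha, hb]
    | hom c a ha =>
      induction x using gr_induction P.gr with
      | zero => simp
      | add x y hx hy => simp only [smul_add, map_add, hx, hy]
      | hom d x hx =>
        rw [h₀_apply d x hx, h₀_apply (c + d) _ (SetLike.GradedSMul.smul_mem ha hx), map_smul,
          grProj_smul 𝒜 V.gr ha]
  refine ⟨⟨⟨⟨h₀, map_add h₀⟩, h₀_smul⟩, fun d x hx => ?_⟩, fun x => ?_⟩
  · change h₀ x ∈ _
    rw [h₀_apply d x hx]
    exact grProj_mem _ _ _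
  · change g (h₀ x) = f x
    induction x using gr_induction P.gr with
    | zero => simp
    | add x y hx hy => simp only [map_add, hx, hy]
    | hom d x hx =>
      have hgp : ∀ y, g (grProj V.gr d y) = grProj W.gr d (g y) := fun y => by
        induction y using gr_induction V.gr with
        | zero => simp
        | hom n y hy =>
          by_cases h : n = d
          · subst h
            rw [grProj_same _ hy, grProj_same _ (g.map_gr _ _ hy)]
          · rw [grProj_of_ne _ hy h, grProj_of_ne _ (g.map_gr _ _ hy) h, map_zero]
        | add x y hx hy => simp only [map_add, hx, hy]
      rw [h₀_apply d x hx, hgp, show g (h x) = f x from LinearMap.congr_fun hh x,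
        grProj_same _ (f.map_gr d x hx)]

/-- A free graded module with a basis of homogeneous elements of degrees `δ j`. -/
noncomputable def free (𝒜 : ℤ → AddSubgroup R) [GradedRing 𝒜] {J : Type u} (δ : J → ℤ) :
    GrMod 𝒜 where
  carrier := J →₀ R
  gr d :=
    { carrier := {f | ∀ j, f j ∈ 𝒜 (d - δ j)}
      add_mem' := fun hf hg j => add_mem (hf j) (hg j)
      zero_mem' := fun j => zero_mem _
      neg_mem' := fun hf j => neg_mem (hf j) }
  decomposition := by
    let p (d : ℤ) : (J →₀ R) →+ (J →₀ R) := Finsupp.liftAddHom fun j =>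
      (Finsupp.singleAddHom j).comp (grProj 𝒜 (d - δ j))
    have hp : ∀ d f j, p d f j = grProj 𝒜 (d - δ j) (f j) := by
      intro d f j
      induction f using Finsupp.induction_linear with
      | zero => simp
      | add f g hf hg => simp only [map_add, Finsupp.add_apply, hf, hg]
      | single i r =>
        classical
        have : p d (Finsupp.single i r) = Finsupp.single i (grProj 𝒜 (d - δ i) r) :=
          Finsupp.liftAddHom_apply_single (fun j =>
            (Finsupp.singleAddHom j).comp (grProj 𝒜 (d - δ j))) i r
        rw [this, Finsupp.single_apply, Finsupp.single_apply]
        split_ifs with h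
        · rw [h]
        · rw [map_zero]
    refine (isInternal_of_proj p (fun d f hf => ?_) (fun d d' h f hf => ?_)
      fun f => ?_).chooseDecomposition
    · ext j
      rw [hp, grProj_same _ (hf j)]
    · ext j
      rw [hp, grProj_of_ne _ (hf j) (by omega)]
      rfl
    · induction f using Finsupp.induction_linear with
      | zero => exact zero_mem _
      | add f g hf hg => exact add_mem hf hg
      | single i r =>
        induction r using gr_induction 𝒜 with
        | zero =>
          rw [Finsupp.single_zero]
          exact zero_mem _
        | add r s hr hs =>
          rw [Finsupp.single_add]
          exact add_mem hr hs
        | hom d r hr =>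
          refine AddSubgroup.mem_iSup_of_mem (d + δ i) fun j => ?_
          classical
          rw [Finsupp.single_apply]
          split_ifs with h
          · subst h
            rwa [add_sub_cancel_right]
          · exact zero_mem _
  gradedSMul := ⟨fun {c d a f} ha hf j => by
    have := SetLike.mul_mem_graded ha (hf j)
    rwa [← add_sub_assoc] at this⟩

instance {J : Type u} (δ : J → ℤ) : Module.Projective R (free 𝒜 δ) :=
  inferInstanceAs (Module.Projective R (J →₀ R))

/-- Every graded module is a quotient of a free graded module. -/
theorem exists_projective_surjective (V : GrMod 𝒜) :
    ∃ (F : GrMod 𝒜) (g : Hom F V), Module.Projective R F ∧ Function.Surjective g := by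
  let v (j : Σ d : ℤ, V.gr d) : V := j.2
  let g : ((Σ d : ℤ, V.gr d) →₀ R) →ₗ[R] V := Finsupp.linearCombination R v
  refine ⟨free 𝒜 (J := Σ d : ℤ, V.gr d) Sigma.fst, ⟨g, fun d f hf => ?_⟩, inferInstance,
    fun x => ?_⟩
  · let f' : (Σ d : ℤ, V.gr d) →₀ R := f
    change Finsupp.linearCombination R v f' ∈ V.gr d
    rw [Finsupp.linearCombination_apply]
    refine sum_mem fun j _ => ?_
    have := SetLike.GradedSMul.smul_mem (hf j) j.2.2
    rwa [vadd_eq_add, sub_add_cancel] at this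
  · change ∃ f, g f = x
    induction x using gr_induction V.gr with
    | zero => exact ⟨0, map_zero _⟩
    | hom d x hx =>
      exact ⟨Finsupp.single ⟨d, x, hx⟩ 1, by
        rw [Finsupp.linearCombination_single, one_smul]⟩
    | add x y hx hy =>
      obtain ⟨a, rfl⟩ := hx
      obtain ⟨b, rfl⟩ := hy
      exact ⟨a + b, map_add _ _ _⟩

/-- A graded projective module is a graded direct summand of a graded free one. -/
theorem IsProjective.projective {P : GrMod 𝒜} (hP : P.IsProjective) : Module.Projective R P := by
  obtain ⟨F, g, hF, hg⟩ := P.exists_projective_surjective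
  obtain ⟨h, hh⟩ := hP F P g P.idHom hg
  exact Module.Projective.of_split h.toLinearMap g.toLinearMap (LinearMap.ext hh)

theorem projDimLT_of_resolution (n : ℕ) (P : ℕ → Type u) [∀ i, AddCommGroup (P i)]
    [∀ i, Module R (P i)] [∀ i, Module.Projective R (P i)] (d : ∀ i, P (i + 1) →ₗ[R] P i)
    (V : Type u) [AddCommGroup V] [Module R V] (ε : P 0 →ₗ[R] V)
    (hP : ∀ i, n < i → Subsingleton (P i)) (hε : Function.Surjective ε)
    (h₀ : Function.Exact (d 0) ε) (hd : ∀ i, Function.Exact (d (i + 1)) (d i)) :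
    ProjDimLT R V (n + 1) := by
  induction n generalizing P V with
  | zero =>
    have hinj : Function.Injective ε := by
      rw [← LinearMap.ker_eq_bot, eq_bot_iff]
      intro x hx
      obtain ⟨y, rfl⟩ := (h₀ x).1 hx
      have := hP 1 one_pos
      rw [Subsingleton.elim y 0, map_zero]
      exact zero_mem _
    exact (ProjDimLT.of_projective one_pos).of_linearEquiv (LinearEquiv.ofBijective ε ⟨hinj, hε⟩)
  | succ n ih =>
    refine ProjDimLT.of_ker ε hε ?_ (ProjDimLT.of_projective (Nat.succ_pos _))
    refine ih (fun i => P (i + 1)) (fun i => d (i + 1)) (LinearMap.ker ε)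
      ((d 0).codRestrict _ fun x => (h₀ _).2 ⟨x, rfl⟩) (fun i hi => hP _ (by omega)) ?_ ?_
      fun i => hd (i + 1)
    · rintro ⟨x, hx⟩
      obtain ⟨y, rfl⟩ := (h₀ x).1 hx
      exact ⟨y, rfl⟩
    · intro x
      rw [← hd 0 x]
      exact Subtype.ext_iff

theorem ProjDimLE.projDimLT {V : GrMod 𝒜} {n : ℕ} (h : V.ProjDimLE n) :
    ProjDimLT R V (n + 1) := by
  obtain ⟨P, d, ε, hP, hn, hε, h₀, hd⟩ := h
  have := fun i => (hP i).projective
  exact projDimLT_of_resolution n (fun i => P i) (fun i => (d i).toLinearMap) V ε.toLinearMap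
    hn hε h₀ hd

omit [GradedRing 𝒜] in
theorem ProjDimLE.of_ker {F V : GrMod 𝒜} (g : Hom F V) (hg : Function.Surjective g)
    (hF : F.IsProjective) {n : ℕ} (h : (ker g).ProjDimLE n) : V.ProjDimLE (n + 1) := by
  obtain ⟨P, d, ε, hP, hn, hε, h₀, hd⟩ := h
  -- F is spliced in at position 0, and the resolution of the kernel moves up by one.
  let P' (i : ℕ) : GrMod 𝒜 := Nat.casesOn i F P
  let d' (i : ℕ) : Hom (P' (i + 1)) (P' i) :=
    Nat.casesOn (motive := fun i => Hom (P' (i + 1)) (P' i)) i ((kerι g).comp ε) d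
  refine ⟨P', d', g, ?_, ?_, hg, ?_, ?_⟩
  · rintro (_ | i)
    exacts [hF, hP i]
  · rintro (_ | i) hi
    exacts [absurd hi (Nat.not_lt_zero _), hn i (by omega)]
  · intro x
    constructor
    · intro hx
      obtain ⟨y, hy⟩ := hε ⟨x, hx⟩
      exact ⟨y, congrArg Subtype.val hy⟩
    · rintro ⟨y, rfl⟩
      exact (ε y).2
  · rintro (_ | i)
    · intro x
      rw [← h₀ x]
      exact (Subtype.ext_iff (a1 := ε x) (a2 := 0)).symm
    · exact hd i

/-- A partial resolution by graded free modules is also an ungraded one, so its last syzygy is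
projective, hence graded projective. -/
theorem ProjDimLE.of_projDimLT {n : ℕ} {V : GrMod 𝒜} (h : ProjDimLT R V (n + 1)) :
    V.ProjDimLE n := by
  induction n generalizing V with
  | zero =>
    have := h.projective
    let P (i : ℕ) : GrMod 𝒜 := Nat.casesOn i V fun _ => zero 𝒜
    have hsub : ∀ i, Subsingleton (P (i + 1)) := fun i => inferInstanceAs (Subsingleton (zero 𝒜))
    refine ⟨P, fun i => zeroHom _ _, V.idHom, ?_, ?_, fun x => ⟨x, rfl⟩, ?_, ?_⟩
    · rintro (_ | i)
      · exact IsProjective.of_projective V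
      · have := hsub i
        exact IsProjective.of_projective _
    · rintro (_ | i) hi
      exacts [absurd hi (Nat.not_lt_zero _), hsub i]
    · intro x
      exact ⟨fun hx => ⟨0, hx.symm⟩, fun ⟨y, hy⟩ => hy.symm⟩
    · intro i x
      have := hsub i
      exact ⟨fun _ => ⟨0, Subsingleton.elim _ _⟩, fun _ => rfl⟩
  | succ n ih =>
    obtain ⟨F, g, hF, hg⟩ := V.exists_projective_surjective
    exact ProjDimLE.of_ker g hg (IsProjective.of_projective F)
      (ih (ProjDimLT.ker g.toLinearMap hg (ProjDimLT.of_projective n.succ_pos) h))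

end GrMod

theorem FiniteLeftGlobalDim.finiteLeftGradedGlobalDim (h : FiniteLeftGlobalDim R) :
    FiniteLeftGradedGlobalDim 𝒜 := by
  obtain ⟨n, hn⟩ := h.exists_succ
  exact ⟨n, fun V => GrMod.ProjDimLE.of_projDimLT (hn V)⟩

end GradedRings

/-! ### The module M[t, t⁻¹] and the passage from graded to ungraded modules -/

section Laurent

variable {R : Type u} [Ring R] (𝒜 : ℤ → AddSubgroup R) [GradedRing 𝒜]
  (M : Type u) [AddCommGroup M] [Module R M]

/-- The endomorphism `m t ^ i ↦ (a m) t ^ (c + i)` of `M[t, t⁻¹]`. -/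
noncomputable def laurentMul (c : ℤ) : R →+ (ℤ →₀ M) →+ (ℤ →₀ M) :=
  AddMonoidHom.mk' (fun a => Finsupp.liftAddHom fun i =>
    (Finsupp.singleAddHom (c + i)).comp (DistribSMul.toAddMonoidHom M a)) fun a b => by
      ext i m
      simp [add_smul]

/-- The action of `R` on `M[t, t⁻¹]` in which elements of degree `c` act through `t ^ c`. -/
noncomputable def laurentAct : R →+ (ℤ →₀ M) →+ (ℤ →₀ M) :=
  (DirectSum.toAddMonoid fun c => (laurentMul M c).comp (𝒜 c).subtype).comp
    (DirectSum.decomposeAddEquiv 𝒜).toAddMonoidHom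

theorem laurentAct_single {c : ℤ} {a : R} (ha : a ∈ 𝒜 c) (i : ℤ) (m : M) :
    laurentAct 𝒜 M a (Finsupp.single i m) = Finsupp.single (c + i) (a • m) := by
  have h : laurentAct 𝒜 M a = laurentMul M c a := by
    change DirectSum.toAddMonoid _ (DirectSum.decompose 𝒜 a) = _
    rw [DirectSum.decompose_of_mem 𝒜 ha, DirectSum.toAddMonoid_of]
    rfl
  rw [h]
  exact Finsupp.liftAddHom_apply_single (fun i =>
    (Finsupp.singleAddHom (c + i)).comp (DistribSMul.toAddMonoidHom M a)) i m

theorem laurentAct_mul (a b : R) (f : ℤ →₀ M) :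
    laurentAct 𝒜 M (a * b) f = laurentAct 𝒜 M a (laurentAct 𝒜 M b f) := by
  induction f using Finsupp.induction_linear with
  | zero => simp
  | add f g hf hg => simp only [map_add, hf, hg]
  | single i m =>
    induction a using gr_induction 𝒜 with
    | zero => simp
    | add a a' ha ha' => simp only [add_mul, map_add, AddMonoidHom.add_apply, ha, ha']
    | hom c a ha =>
      induction b using gr_induction 𝒜 with
      | zero => simp
      | add b b' hb hb' => simp only [mul_add, map_add, AddMonoidHom.add_apply, hb, hb']
      | hom d b hb =>
        rw [laurentAct_single 𝒜 M hb, laurentAct_single 𝒜 M ha,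
          laurentAct_single 𝒜 M (SetLike.mul_mem_graded ha hb), mul_smul, add_assoc]

theorem laurentAct_one (f : ℤ →₀ M) : laurentAct 𝒜 M 1 f = f := by
  induction f using Finsupp.induction_linear with
  | zero => simp
  | add f g hf hg => simp only [map_add, hf, hg]
  | single i m => rw [laurentAct_single 𝒜 M SetLike.GradedOne.one_mem, zero_add, one_smul]

/-- The module `M[t, t⁻¹]` over a graded ring, for a module `M` without grading. -/
def LaurentModule (_ : ℤ → AddSubgroup R) (M : Type u) [AddCommGroup M] : Type u := ℤ →₀ M

noncomputable instance : AddCommGroup (LaurentModule 𝒜 M) := inferInstanceAs (AddCommGroup (ℤ →₀ M))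

noncomputable instance : Module R (LaurentModule 𝒜 M) where
  smul a f := laurentAct 𝒜 M a f
  one_smul := laurentAct_one 𝒜 M
  mul_smul := laurentAct_mul 𝒜 M
  smul_zero a := map_zero (laurentAct 𝒜 M a)
  smul_add a := map_add (laurentAct 𝒜 M a)
  add_smul a b f := DFunLike.congr_fun (map_add (laurentAct 𝒜 M) a b) f
  zero_smul f := DFunLike.congr_fun (map_zero (laurentAct 𝒜 M)) f

/-- The grading of `M[t, t⁻¹]`. -/
noncomputable def laurentGrading (d : ℤ) : AddSubgroup (LaurentModule 𝒜 M) :=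
  AddMonoidHom.range (Finsupp.singleAddHom d : M →+ (ℤ →₀ M))

omit [GradedRing 𝒜] [Module R M] in
theorem laurentGrading_isInternal : DirectSum.IsInternal (laurentGrading 𝒜 M) := by
  refine isInternal_of_proj (M := LaurentModule 𝒜 M) (fun d => (Finsupp.singleAddHom d).comp
    (Finsupp.applyAddHom d : (ℤ →₀ M) →+ M)) ?_ ?_ fun f => ?_
  · rintro d _ ⟨m, rfl⟩
    exact congrArg (Finsupp.single d) (Finsupp.single_eq_same (a := d) (b := m))
  · rintro d d' h _ ⟨m, rfl⟩
    exact (congrArg (Finsupp.single d')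
      (Finsupp.single_eq_of_ne (a := d) (b := m) (Ne.symm h))).trans (Finsupp.single_zero d')
  · induction f using Finsupp.induction_linear with
    | zero => exact zero_mem _
    | add f g hf hg => exact add_mem hf hg
    | single i m => exact AddSubgroup.mem_iSup_of_mem i ⟨m, rfl⟩

/-- The graded module `M[t, t⁻¹]` over a graded ring, for a module `M` without grading. -/
noncomputable def GrMod.laurent : GrMod 𝒜 where
  carrier := LaurentModule 𝒜 M
  gr := laurentGrading 𝒜 M
  decomposition := (laurentGrading_isInternal 𝒜 M).chooseDecomposition
  gradedSMul := ⟨by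
    rintro c d a _ ha ⟨m, rfl⟩
    exact ⟨a • m, (laurentAct_single 𝒜 M ha d m).symm⟩⟩

/-- Additive maps commuting with the action of homogeneous elements on monomials are linear. -/
noncomputable def laurentHom {N : Type u} [AddCommGroup N] [Module R N]
    (g : (ℤ →₀ M) →+ N) (hg : ∀ c, ∀ a ∈ 𝒜 c, ∀ (i : ℤ) (m : M),
      g (Finsupp.single (c + i) (a • m)) = a • g (Finsupp.single i m)) :
    LaurentModule 𝒜 M →ₗ[R] N where
  toFun f := g f
  map_add' := map_add g
  map_smul' a f := by
    change g (laurentAct 𝒜 M a f) = a • g f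
    induction f using Finsupp.induction_linear with
    | zero => simp
    | add f g hf hg => simp only [map_add, smul_add, hf, hg]
    | single i m =>
      induction a using gr_induction 𝒜 with
      | zero => simp
      | add a a' ha ha' => simp only [map_add, AddMonoidHom.add_apply, add_smul, ha, ha']
      | hom c a ha => rw [laurentAct_single 𝒜 M ha, hg c a ha]

/-- Multiplication by t - 1 (the map `δ`) and evaluation at t = 1 (the map `ev`) form a short exact
sequence 0 → M[t, t⁻¹] → M[t, t⁻¹] → M → 0. Both are R-linear: multiplication by t commutes with the
powers t ^ c through which R acts, and these become 1 at t = 1. -/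
theorem ProjDimLT.of_laurent {n : ℕ} (h : ProjDimLT R (LaurentModule 𝒜 M) n) :
    ProjDimLT R M (n + 1) := by
  let E : (ℤ →₀ M) →+ M := Finsupp.liftAddHom fun _ => AddMonoidHom.id M
  have hE : ∀ i m, E (Finsupp.single i m) = m := fun i m =>
    Finsupp.liftAddHom_apply_single (fun _ => AddMonoidHom.id M) i m
  let D : (ℤ →₀ M) →+ (ℤ →₀ M) := Finsupp.mapDomain.addMonoidHom (· + 1) - AddMonoidHom.id _
  have hD : ∀ f, D f = Finsupp.mapDomain (· + 1) f - f := fun f => rfl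
  have hDs : ∀ i m, D (Finsupp.single i m) = Finsupp.single (i + 1) m - Finsupp.single i m :=
    fun i m => by rw [hD, Finsupp.mapDomain_single]
  let ev : LaurentModule 𝒜 M →ₗ[R] M := laurentHom 𝒜 M E fun c a ha i m => by
    rw [hE, hE]
  let δ : LaurentModule 𝒜 M →ₗ[R] LaurentModule 𝒜 M :=
    laurentHom 𝒜 M (N := LaurentModule 𝒜 M) D fun c a ha i m => by
      change D _ = laurentAct 𝒜 M a (D _)
      rw [hDs, hDs, map_sub, laurentAct_single 𝒜 M ha, laurentAct_single 𝒜 M ha, add_assoc]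
  have hED : ∀ f, E (D f) = 0 := by
    intro f
    induction f using Finsupp.induction_linear with
    | zero => simp
    | add f g hf hg => rw [map_add, map_add, hf, hg, add_zero]
    | single i m => rw [hDs, map_sub, hE, hE, sub_self]
  -- t ^ i - 1 is divisible by t - 1, for negative i as well.
  have hconst : ∀ (i : ℤ) (m : M), Finsupp.single i m - Finsupp.single 0 m ∈ D.range := by
    intro i m
    induction i using Int.induction_on with
    | zero => rw [sub_self]; exact zero_mem _
    | succ i ih =>
      have h1 : D (Finsupp.single (i : ℤ) m) ∈ D.range := ⟨_, rfl⟩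
      rw [hDs] at h1
      simpa using add_mem h1 ih
    | pred i ih =>
      have h1 : D (Finsupp.single (-(i : ℤ) - 1) m) ∈ D.range := ⟨_, rfl⟩
      rw [hDs, sub_add_cancel] at h1
      simpa using sub_mem ih h1
  have hrange : ∀ f, f - Finsupp.single 0 (E f) ∈ D.range := by
    intro f
    induction f using Finsupp.induction_linear with
    | zero => simp
    | add f g hf hg =>
      have := add_mem hf hg
      rwa [map_add, Finsupp.single_add, add_sub_add_comm]
    | single i m => rw [hE]; exact hconst i m
  refine ProjDimLT.right (f := δ) (g := ev) ?_ ?_ ?_ h (h.mono n.le_succ)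
  · intro f
    constructor
    · intro hf
      obtain ⟨g, hg⟩ := hrange f
      refine ⟨g, hg.trans ?_⟩
      rw [show E f = 0 from hf, Finsupp.single_zero]
      exact sub_zero (f : ℤ →₀ M)
    · rintro ⟨g, rfl⟩
      exact hED g
  · rw [injective_iff_map_eq_zero]
    intro (f : ℤ →₀ M) hf
    have hf' : Finsupp.mapDomain (· + 1) f - f = 0 := hf
    rw [sub_eq_zero] at hf'
    have hstep : ∀ i : ℤ, (f : ℤ →₀ M) (i + 1) = (f : ℤ →₀ M) i := fun i => by
      conv_lhs => rw [← hf']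
      exact Finsupp.mapDomain_apply (add_left_injective 1) f i
    have hcst : ∀ (i : ℤ) (k : ℕ), (f : ℤ →₀ M) (i + k) = (f : ℤ →₀ M) i := by
      intro i k
      induction k with
      | zero => simp
      | succ k ih => rw [Nat.cast_succ, ← add_assoc, hstep, ih]
    -- If t f = f, a nonzero coefficient would repeat in all higher degrees, against finite support.
    refine Finsupp.ext fun i => ?_
    by_contra hi
    have : Set.Infinite {j | (f : ℤ →₀ M) j ≠ 0} := by
      refine Set.infinite_of_injective_forall_mem (f := fun k : ℕ => i + (k : ℤ)) ?_ ?_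
      · intro a b hab
        simpa using hab
      · intro k
        change (f : ℤ →₀ M) (i + k) ≠ 0
        rw [hcst]
        exact hi
    exact this (Finsupp.hasFiniteSupport (f : ℤ →₀ M))
  · exact fun m => ⟨(Finsupp.single 0 m : ℤ →₀ M), hE 0 m⟩

variable {𝒜}

/-- A graded ring of finite graded global dimension has finite global dimension. -/
theorem FiniteLeftGradedGlobalDim.finiteLeftGlobalDim (h : FiniteLeftGradedGlobalDim 𝒜) :
    FiniteLeftGlobalDim R := by
  obtain ⟨n, hn⟩ := h
  -- One unit turns `≤ n` into `< n + 1`, the other is the loss in the Laurent sequence.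
  exact ⟨n + 2, fun M _ _ => ProjDimLT.of_laurent 𝒜 M (hn (GrMod.laurent 𝒜 M)).projDimLT⟩

end Laurent

/-! ### Graded Noetherian rings with grading bounded below are Noetherian -/

section Noetherian

variable {R : Type u} [Ring R] (𝒜 : ℤ → AddSubgroup R) [GradedRing 𝒜]

/-- The leading terms of degree `d` of the elements of a left ideal. -/
def leadingTerms (I : Ideal R) (d : ℤ) : AddSubgroup R where
  carrier := {x | ∃ y ∈ I, grProj 𝒜 d y = x ∧ ∀ d', d < d' → grProj 𝒜 d' y = 0}
  add_mem' := by
    rintro _ _ ⟨y, hy, rfl, hy'⟩ ⟨z, hz, rfl, hz'⟩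
    exact ⟨y + z, add_mem hy hz, map_add _ _ _, fun d' hd => by
      rw [map_add, hy' d' hd, hz' d' hd, add_zero]⟩
  zero_mem' := ⟨0, zero_mem _, map_zero _, fun _ _ => map_zero _⟩
  neg_mem' := by
    rintro _ ⟨y, hy, rfl, hy'⟩
    exact ⟨-y, neg_mem hy, map_neg _ _, fun d' hd => by rw [map_neg, hy' d' hd, neg_zero]⟩

/-- The homogeneous left ideal of leading terms of a left ideal. -/
def leadingIdeal (I : Ideal R) : Ideal R where
  carrier := {x | ∀ d, grProj 𝒜 d x ∈ leadingTerms 𝒜 I d}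
  add_mem' hx hy d := by
    rw [map_add]
    exact add_mem (hx d) (hy d)
  zero_mem' d := by
    rw [map_zero]
    exact zero_mem _
  smul_mem' a x hx d := by
    induction a using gr_induction 𝒜 with
    | zero =>
      rw [zero_smul, map_zero]
      exact zero_mem _
    | add a b ha hb =>
      rw [add_smul, map_add]
      exact add_mem ha hb
    | hom c a ha =>
      obtain ⟨d, rfl⟩ : ∃ e, d = c + e := ⟨d - c, by omega⟩
      rw [grProj_smul 𝒜 𝒜 ha]
      obtain ⟨y, hy, hyx, hy'⟩ := hx d
      refine ⟨a • y, I.smul_mem a hy, ?_, fun d' hd => ?_⟩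
      · rw [grProj_smul 𝒜 𝒜 ha, hyx]
      · obtain ⟨e, rfl⟩ : ∃ e, d' = c + e := ⟨d' - c, by omega⟩
        rw [grProj_smul 𝒜 𝒜 ha, hy' e (by omega), smul_zero]

theorem leadingIdeal_isHomogeneous (I : Ideal R) : (leadingIdeal 𝒜 I).IsHomogeneous 𝒜 := by
  intro i x hx d
  change grProj 𝒜 d (grProj 𝒜 i x) ∈ _
  by_cases h : i = d
  · subst h
    rw [grProj_same 𝒜 (grProj_mem 𝒜 i x)]
    exact hx i
  · rw [grProj_of_ne 𝒜 (grProj_mem 𝒜 i x) h]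
    exact zero_mem _

theorem leadingIdeal_mono {I J : Ideal R} (h : I ≤ J) : leadingIdeal 𝒜 I ≤ leadingIdeal 𝒜 J := by
  intro x hx d
  obtain ⟨y, hy, hyx⟩ := hx d
  exact ⟨y, h hy, hyx⟩

variable {𝒜}

/-- An element of J has the same leading term as some element of I; subtracting lowers the degree,
and this stops because the grading is bounded below. -/
theorem eq_of_leadingIdeal_eq {N : ℤ} (hN : ∀ d < N, 𝒜 d = ⊥) {I J : Ideal R} (hIJ : I ≤ J)
    (h : leadingIdeal 𝒜 I = leadingIdeal 𝒜 J) : I = J := by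
  refine le_antisymm hIJ fun y hy => ?_
  have key : ∀ (m : ℕ), ∀ y ∈ J, (∀ d, N + m ≤ d → grProj 𝒜 d y = 0) → y ∈ I := by
    intro m
    induction m with
    | zero =>
      intro y _ hd
      have : y = 0 := eq_zero_of_grProj 𝒜 fun d => by
        by_cases hdN : d < N
        · have := grProj_mem 𝒜 d y
          rwa [hN d hdN, AddSubgroup.mem_bot] at this
        · exact hd d (by push_cast; omega)
      rw [this]
      exact zero_mem _
    | succ m ih =>
      intro y hy hd
      have h1 : grProj 𝒜 (N + m) y ∈ leadingIdeal 𝒜 J := fun d => by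
        by_cases hdm : N + m = d
        · subst hdm
          rw [grProj_same 𝒜 (grProj_mem 𝒜 _ y)]
          exact ⟨y, hy, rfl, fun d' hd' => hd d' (by push_cast; omega)⟩
        · rw [grProj_of_ne 𝒜 (grProj_mem 𝒜 _ y) hdm]
          exact zero_mem _
      rw [← h] at h1
      obtain ⟨z, hz, hzy, hz'⟩ := h1 (N + m)
      rw [grProj_same 𝒜 (grProj_mem 𝒜 _ y)] at hzy
      have h2 : y - z ∈ I := ih (y - z) (sub_mem hy (hIJ hz)) fun d hdm => by
        rw [map_sub]
        rcases hdm.eq_or_lt with rfl | hlt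
        · rw [hzy, sub_self]
        · rw [hz' d hlt, hd d (by push_cast; omega), sub_self]
      simpa using add_mem h2 hz
  obtain ⟨s, hs⟩ := exists_sum_grProj 𝒜 y
  obtain ⟨b, hb⟩ := s.bddAbove
  -- With b a bound for the degrees occurring in y, this exponent makes N + m at least b + 1.
  refine key (b + 1 - N).toNat y hy fun d hd => ?_
  rw [hs, map_sum]
  refine Finset.sum_eq_zero fun d' hd' => grProj_of_ne 𝒜 (grProj_mem 𝒜 d' y) ?_
  have := hb hd'
  omega

/-- A ring with a grading that is bounded below is left Noetherian if it is left graded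
Noetherian. -/
theorem LeftGradedNoetherian.isNoetherianRing (h : LeftGradedNoetherian 𝒜) {N : ℤ}
    (hN : ∀ d < N, 𝒜 d = ⊥) : IsNoetherianRing R := by
  let V : GrMod 𝒜 := { carrier := R, gr := 𝒜 }
  have : Module.Projective R V := inferInstanceAs (Module.Projective R R)
  have hV := h V (GrMod.IsProjective.of_projective V) (inferInstanceAs (Module.Finite R R))
  rw [isNoetherianRing_iff, ← monotone_stabilizes_iff_noetherian]
  intro f
  obtain ⟨n, hn⟩ := hV ⟨fun i => leadingIdeal 𝒜 (f i), fun i j hij =>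
    leadingIdeal_mono 𝒜 (f.monotone hij)⟩ fun i => leadingIdeal_isHomogeneous 𝒜 (f i)
  exact ⟨n, fun m hm => eq_of_leadingIdeal_eq hN (f.monotone hm) (hn m hm).symm⟩

end Noetherian

/-! ### The grading of the opposite ring -/

section Opposite

variable {R : Type u} [Ring R] (𝒜 : ℤ → AddSubgroup R) [GradedRing 𝒜]

omit [GradedRing 𝒜] in
theorem op_mem_opGrading {d : ℤ} {a : R} (ha : a ∈ 𝒜 d) : MulOpposite.op a ∈ opGrading 𝒜 d :=
  ⟨a, ha, rfl⟩

noncomputable instance : GradedRing (opGrading 𝒜) where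
  one_mem := op_mem_opGrading 𝒜 SetLike.GradedOne.one_mem
  mul_mem := by
    rintro i j _ _ ⟨a, ha, rfl⟩ ⟨b, hb, rfl⟩
    rw [add_comm]
    exact op_mem_opGrading 𝒜 (SetLike.mul_mem_graded hb ha)
  toDecomposition := by
    let p (d : ℤ) : Rᵐᵒᵖ →+ Rᵐᵒᵖ := ((MulOpposite.opAddEquiv (α := R)).toAddMonoidHom.comp
      (grProj 𝒜 d)).comp (MulOpposite.opAddEquiv (α := R)).symm.toAddMonoidHom
    have hp : ∀ d a, p d (MulOpposite.op a) = MulOpposite.op (grProj 𝒜 d a) := fun _ _ => rfl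
    refine (isInternal_of_proj p ?_ ?_ fun x => ?_).chooseDecomposition
    · rintro d _ ⟨a, ha, rfl⟩
      exact congrArg MulOpposite.op (grProj_same 𝒜 ha)
    · rintro d d' h _ ⟨a, ha, rfl⟩
      exact congrArg MulOpposite.op (grProj_of_ne 𝒜 ha h)
    · obtain ⟨a, rfl⟩ := MulOpposite.op_surjective x
      induction a using gr_induction 𝒜 with
      | zero => exact zero_mem _
      | hom d a ha => exact AddSubgroup.mem_iSup_of_mem d (op_mem_opGrading 𝒜 ha)
      | add a b ha hb => exact add_mem ha hb

omit [GradedRing 𝒜] in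
theorem opGrading_eq_bot {d : ℤ} (h : 𝒜 d = ⊥) : opGrading 𝒜 d = ⊥ := by
  rw [opGrading, h, AddSubgroup.map_bot]

end Opposite

instance gradedRingToAddSubgroup {k : Type v} [Field k] {A : Type u} [Ring A] [Algebra k A]
    (𝒜 : ℤ → Submodule k A) [GradedAlgebra 𝒜] : GradedRing (fun d => (𝒜 d).toAddSubgroup) where
  one_mem := SetLike.GradedOne.one_mem (A := 𝒜)
  mul_mem _ _ _ _ ha hb := SetLike.GradedMul.mul_mem (A := 𝒜) ha hb
  decompose' := DirectSum.decompose 𝒜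
  left_inv := (DirectSum.decompose 𝒜).left_inv
  right_inv := (DirectSum.decompose 𝒜).right_inv

/-! ### Weights and the triangular basis -/

section Triangular

variable {k : Type v} [Field k] {A : Type u} [Ring A] [Algebra k A]

theorem mul_of_mem_sandwich {x y a : A} (hx : IsIdempotentElem x) (ha : a ∈ sandwich k x y) :
    x * a = a := by
  obtain ⟨b, rfl⟩ := ha
  rw [LinearMap.mulLeftRight_apply, mul_assoc, ← mul_assoc x x, hx.eq]

theorem mul_of_mem_sandwich' {x y a : A} (hy : IsIdempotentElem y) (ha : a ∈ sandwich k x y) :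
    a * y = a := by
  obtain ⟨b, rfl⟩ := ha
  rw [LinearMap.mulLeftRight_apply, mul_assoc, hy.eq]

namespace GradedTriangularBasis

variable {𝒜 : ℤ → Submodule k A} {I : Type w} {e : I → A} {L : Type w'} [PartialOrder L]
  (T : GradedTriangularBasis 𝒜 e L)

/-- The triples `(x, h, y)` that index the triangular basis. -/
abbrev Index : Type u :=
  (⋃ (s : T.S) (t : T.S), (⋃ i, T.X i s) ×ˢ (T.H s t ×ˢ ⋃ j, T.Y t j) : Set (A × A × A))

/-- The element `x h y` of the triangular basis. -/
def vec (p : T.Index) : A := p.1.1 * p.1.2.1 * p.1.2.2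

theorem exists_of_index (p : T.Index) : ∃ (i : I) (s t : T.S) (j : I),
    p.1.1 ∈ T.X i s ∧ p.1.2.1 ∈ T.H s t ∧ p.1.2.2 ∈ T.Y t j := by
  obtain ⟨⟨x, h, y⟩, hp⟩ := p
  simp only [Set.mem_iUnion, Set.mem_prod] at hp
  obtain ⟨s, t, ⟨i, hx⟩, hh, j, hy⟩ := hp
  exact ⟨i, s, t, j, hx, hh, hy⟩

/-- The index `(x, h, y)`. -/
def mkIndex {i : I} {s t : T.S} {j : I} {x h y : A} (hx : x ∈ T.X i s) (hh : h ∈ T.H s t)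
    (hy : y ∈ T.Y t j) : T.Index :=
  ⟨(x, h, y), by
    simp only [Set.mem_iUnion, Set.mem_prod]
    exact ⟨s, t, ⟨i, hx⟩, hh, j, hy⟩⟩

/-- The index `i` of the row of `x h y`. -/
noncomputable def row (p : T.Index) : I := (T.exists_of_index p).choose

/-- The index `s` with `h ∈ H(s, t)`. -/
noncomputable def src (p : T.Index) : T.S := (T.exists_of_index p).choose_spec.choose

/-- The index `t` with `h ∈ H(s, t)`. -/
noncomputable def tgt (p : T.Index) : T.S := (T.exists_of_index p).choose_spec.choose_spec.choose

/-- The index `j` of the column of `x h y`. -/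
noncomputable def col (p : T.Index) : I :=
  (T.exists_of_index p).choose_spec.choose_spec.choose_spec.choose

theorem fst_mem (p : T.Index) : p.1.1 ∈ T.X (T.row p) (T.src p) :=
  (T.exists_of_index p).choose_spec.choose_spec.choose_spec.choose_spec.1

theorem mid_mem (p : T.Index) : p.1.2.1 ∈ T.H (T.src p) (T.tgt p) :=
  (T.exists_of_index p).choose_spec.choose_spec.choose_spec.choose_spec.2.1

theorem snd_mem (p : T.Index) : p.1.2.2 ∈ T.Y (T.tgt p) (T.col p) :=
  (T.exists_of_index p).choose_spec.choose_spec.choose_spec.choose_spec.2.2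

/-- The weight of a basis element. -/
noncomputable def weight (p : T.Index) : L := T.dot (T.src p)

/-- Nonempty H(s, t) forces equal weights, so the weight of a basis element can be read off on
either side of h. -/
theorem dot_tgt (p : T.Index) : T.dot (T.tgt p) = T.weight p := by
  by_cases h : T.src p = T.tgt p
  · rw [weight, h]
  · exact (T.H_ne _ _ h ⟨_, T.mid_mem p⟩).symm

/-- The triangular basis as a basis of a vector space. -/
noncomputable def basis : Module.Basis T.Index k A :=
  Module.Basis.mk (v := T.vec) T.linearIndependent T.span_eq_top.ge

theorem basis_apply (p : T.Index) : T.basis p = T.vec p := Module.Basis.mk_apply _ _ _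

theorem vec_ne_zero (p : T.Index) : T.vec p ≠ 0 := by
  have : Nontrivial k := inferInstance
  exact T.linearIndependent.ne_zero p

theorem mid_ne_zero (p : T.Index) : p.1.2.1 ≠ 0 := fun h =>
  T.vec_ne_zero p (by rw [vec, h, mul_zero, zero_mul])

variable {T} (hA : IsLocallyUnital 𝒜 e)

section Idempotents

include hA

theorem idem_mul_x {i : I} {s : T.S} {x : A} (hx : x ∈ T.X i s) : e i * x = x :=
  mul_of_mem_sandwich (hA.orthogonal.idem i) (T.X_mem i s x hx).2

theorem x_mul_idem {i : I} {s : T.S} {x : A} (hx : x ∈ T.X i s) : x * e s = x :=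
  mul_of_mem_sandwich' (hA.orthogonal.idem _) (T.X_mem i s x hx).2

theorem idem_mul_h {s t : T.S} {h : A} (hh : h ∈ T.H s t) : e s * h = h :=
  mul_of_mem_sandwich (hA.orthogonal.idem _) (T.H_mem s t h hh).2

theorem h_mul_idem {s t : T.S} {h : A} (hh : h ∈ T.H s t) : h * e t = h :=
  mul_of_mem_sandwich' (hA.orthogonal.idem _) (T.H_mem s t h hh).2

theorem idem_mul_y {t : T.S} {j : I} {y : A} (hy : y ∈ T.Y t j) : e t * y = y :=
  mul_of_mem_sandwich (hA.orthogonal.idem _) (T.Y_mem t j y hy).2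

theorem y_mul_idem {t : T.S} {j : I} {y : A} (hy : y ∈ T.Y t j) : y * e j = y :=
  mul_of_mem_sandwich' (hA.orthogonal.idem _) (T.Y_mem t j y hy).2

theorem idem_mul_vec (p : T.Index) : e (T.row p) * T.vec p = T.vec p := by
  rw [vec, ← mul_assoc, ← mul_assoc, idem_mul_x hA (T.fst_mem p)]

theorem vec_mul_idem (p : T.Index) : T.vec p * e (T.col p) = T.vec p := by
  rw [vec, mul_assoc, y_mul_idem hA (T.snd_mem p)]

/-- Shows that the chosen indices of a basis element do not depend on the choice: a nonzero element
is fixed by at most one of the orthogonal idempotents. -/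
theorem index_eq {i j : I} {a : A} (ha : a ≠ 0) (h₁ : e i * a = a) (h₂ : e j * a = a) : i = j := by
  by_contra h
  exact ha (by rw [← h₁, ← h₂, ← mul_assoc, hA.orthogonal.ortho h, zero_mul])

theorem index_eq' {i j : I} {a : A} (ha : a ≠ 0) (h₁ : a * e i = a) (h₂ : a * e j = a) :
    i = j := by
  by_contra h
  exact ha (by rw [← h₁, ← h₂, mul_assoc, hA.orthogonal.ortho (Ne.symm h), mul_zero])

theorem src_eq {p : T.Index} {s t : T.S} (h : p.1.2.1 ∈ T.H s t) : T.src p = s :=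
  Subtype.ext (index_eq hA (T.mid_ne_zero p) (idem_mul_h hA (T.mid_mem p)) (idem_mul_h hA h))

theorem tgt_eq {p : T.Index} {s t : T.S} (h : p.1.2.1 ∈ T.H s t) : T.tgt p = t :=
  Subtype.ext (index_eq' hA (T.mid_ne_zero p) (h_mul_idem hA (T.mid_mem p)) (h_mul_idem hA h))

theorem weight_mkIndex {i : I} {s t : T.S} {j : I} {x h y : A} (hx : x ∈ T.X i s)
    (hh : h ∈ T.H s t) (hy : y ∈ T.Y t j) : T.weight (T.mkIndex hx hh hy) = T.dot s := by
  rw [weight, src_eq hA (p := T.mkIndex hx hh hy) hh]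

theorem mem_span_row {i : I} {a : A} (ha : e i * a = a) :
    a ∈ Submodule.span k (T.vec '' {p | T.row p = i}) := by
  have htop : a ∈ Submodule.span k (Set.range T.vec) := by
    rw [show Submodule.span k (Set.range T.vec) = ⊤ from T.span_eq_top]; trivial
  rw [← ha]
  refine Submodule.span_induction (p := fun a _ =>
    e i * a ∈ Submodule.span k (T.vec '' {p | T.row p = i})) ?_ ?_ ?_ ?_ htop
  · rintro _ ⟨p, rfl⟩
    by_cases h : T.row p = i
    · rw [← h, idem_mul_vec hA, h]
      exact Submodule.subset_span ⟨p, h, rfl⟩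
    · rw [← idem_mul_vec hA p, ← mul_assoc, hA.orthogonal.ortho (Ne.symm h), zero_mul]
      exact zero_mem _
  · rw [mul_zero]
    exact zero_mem _
  · intro a b _ _ ha hb
    rw [mul_add]
    exact add_mem ha hb
  · intro c a _ ha
    rw [mul_smul_comm]
    exact Submodule.smul_mem _ c ha

theorem span_mul_idem (D : Set T.Index) {j : I} {a : A}
    (ha : a ∈ Submodule.span k (T.vec '' D)) :
    a * e j ∈ Submodule.span k (T.vec '' {p | p ∈ D ∧ T.col p = j}) := by
  refine Submodule.span_induction (p := fun a _ =>
    a * e j ∈ Submodule.span k (T.vec '' {p | p ∈ D ∧ T.col p = j})) ?_ ?_ ?_ ?_ ha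
  · rintro _ ⟨p, hp, rfl⟩
    by_cases h : T.col p = j
    · rw [← h, vec_mul_idem hA, h]
      exact Submodule.subset_span ⟨p, ⟨hp, h⟩, rfl⟩
    · rw [← vec_mul_idem hA p, mul_assoc, hA.orthogonal.ortho h, mul_zero]
      exact zero_mem _
  · rw [zero_mul]
    exact zero_mem _
  · intro a b _ _ ha hb
    rw [add_mul]
    exact add_mem ha hb
  · intro c a _ ha
    rw [smul_mul_assoc]
    exact Submodule.smul_mem _ c ha

theorem mem_span_col {j : I} {a : A} (ha : a * e j = a) :
    a ∈ Submodule.span k (T.vec '' {p | T.col p = j}) := by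
  have htop : a ∈ Submodule.span k (T.vec '' Set.univ) := by
    rw [Set.image_univ, show Submodule.span k (Set.range T.vec) = ⊤ from T.span_eq_top]
    trivial
  have := span_mul_idem hA Set.univ (j := j) htop
  rw [ha] at this
  simpa using this

theorem mem_span_row_col {i j : I} {a : A} (hi : e i * a = a) (hj : a * e j = a) :
    a ∈ Submodule.span k (T.vec '' {p | T.row p = i ∧ T.col p = j}) := by
  have := span_mul_idem hA _ (j := j) (mem_span_row hA (T := T) hi)
  rwa [hj] at this

end Idempotents

variable (T) in
/-- The span of the basis elements with weights in a given set. -/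
def weightSpan (Γ : Set L) : Submodule k A := Submodule.span k (T.vec '' {p | T.weight p ∈ Γ})

theorem weightSpan_mono {Γ Δ : Set L} (h : Γ ⊆ Δ) : T.weightSpan Γ ≤ T.weightSpan Δ :=
  Submodule.span_mono (Set.image_mono fun _ hp => h hp)

theorem vec_mem_weightSpan {Γ : Set L} {p : T.Index} (h : T.weight p ∈ Γ) :
    T.vec p ∈ T.weightSpan Γ := Submodule.subset_span ⟨p, h, rfl⟩

variable (T) in
include T in
-- The size of the finite set of weights below l is strictly increasing in l.
theorem wellFounded_lt : WellFounded ((· < ·) : L → L → Prop) := by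
  refine Subrelation.wf (r := InvImage (· < ·) fun l : L => (Set.Iic l).ncard) ?_
    (InvImage.wf _ _root_.wellFounded_lt)
  intro a b hab
  exact Set.ncard_lt_ncard (Set.Iic_ssubset_Iic.2 hab) (T.lower_finite b)

theorem mul_mem_of_span {D D' : Set T.Index} {K : Submodule k A} {f : A →ₗ[k] A}
    (h : ∀ p ∈ D, ∀ q ∈ D', f (T.vec p * T.vec q) ∈ K) {a b : A}
    (ha : a ∈ Submodule.span k (T.vec '' D)) (hb : b ∈ Submodule.span k (T.vec '' D')) :
    f (a * b) ∈ K := by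
  have : a * b ∈ Submodule.map₂ (LinearMap.mul k A) (Submodule.span k (T.vec '' D))
      (Submodule.span k (T.vec '' D')) := Submodule.apply_mem_map₂ _ ha hb
  rw [Submodule.map₂_span_span] at this
  have hle : Submodule.span k (Set.image2 (fun m n => (LinearMap.mul k A) m n) (T.vec '' D)
      (T.vec '' D')) ≤ K.comap f := by
    rw [Submodule.span_le]
    rintro _ ⟨_, ⟨p, hp, rfl⟩, _, ⟨q, hq, rfl⟩, rfl⟩
    exact h p hp q hq
  exact hle this

include hA

/-- The ideal `A 1_s A` is contained in the span of the basis elements of weight at most the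
weight of `s`. -/
theorem mul_idem_mul_mem (s : T.S) (a b : A) : a * e s * b ∈ T.weightSpan (Set.Iic (T.dot s)) := by
  induction hl : T.dot s using T.wellFounded_lt.induction generalizing s a b with
  | _ l ih =>
  have ih' : ∀ (t : T.S), T.dot t < l → ∀ a b, a * e t * b ∈ T.weightSpan (Set.Iic l) :=
    fun t ht a b => weightSpan_mono (Set.Iic_subset_Iic.2 ht.le) (ih _ ht t a b rfl)
  have hcol := mem_span_col hA (T := T) (j := (s : I)) (a := a * e s)
    (by rw [mul_assoc, (hA.orthogonal.idem _).eq])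
  have hrow := mem_span_row hA (T := T) (i := (s : I)) (a := e s * b)
    (by rw [← mul_assoc, (hA.orthogonal.idem _).eq])
  have key := mul_mem_of_span (K := T.weightSpan (Set.Iic l)) (f := LinearMap.id)
    (fun p (hp : T.col p = s) q (hq : T.row q = s) => ?_) hcol hrow
  · rwa [LinearMap.id_apply, mul_assoc, ← mul_assoc (e s), (hA.orthogonal.idem _).eq,
      ← mul_assoc] at key
  rw [LinearMap.id_apply]
  have hy := T.snd_mem p
  have hx := T.fst_mem q
  rw [hp] at hy
  rw [hq] at hx
  -- If y ∈ Y(t, s) with t ≠ s, the product passes through 1_t of strictly smaller weight, and the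
  -- induction hypothesis applies; likewise for x on the other side. What remains is y = x = 1_s,
  -- where the product is x (h h') y' with two middle factors.
  by_cases htp : T.tgt p = s
  swap
  · have := ih' (T.tgt p) (hl ▸ T.Y_ne _ _ htp ⟨_, hy⟩) (p.1.1 * p.1.2.1) (p.1.2.2 * T.vec q)
    rwa [← mul_assoc, mul_assoc _ _ p.1.2.2, idem_mul_y hA hy] at this
  by_cases hsq : T.src q = s
  swap
  · have := ih' (T.src q) (hl ▸ T.X_ne _ _ (Ne.symm hsq) ⟨_, hx⟩) (T.vec p * q.1.1)
      (q.1.2.1 * q.1.2.2)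
    rwa [mul_assoc (T.vec p), x_mul_idem hA hx, mul_assoc, ← mul_assoc q.1.1] at this
  rw [htp, T.Y_self, Set.mem_singleton_iff] at hy
  rw [hsq, T.X_self, Set.mem_singleton_iff] at hx
  have hhp := T.mid_mem p
  have hhq := T.mid_mem q
  have hxp := T.fst_mem p
  have hyq := T.snd_mem q
  have hwp : T.dot (T.src p) = l := by rw [← hl, ← htp, T.dot_tgt]; rfl
  have hwq : T.dot (T.tgt q) = l := by rw [← hl, ← hsq, T.dot_tgt]; rfl
  have hvec : T.vec p * T.vec q = p.1.1 * (p.1.2.1 * q.1.2.1) * q.1.2.2 := by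
    have h1 : p.1.2.1 * e s = p.1.2.1 := by
      rw [htp] at hhp
      exact h_mul_idem hA hhp
    have h2 : e s * q.1.2.1 = q.1.2.1 := by
      rw [hsq] at hhq
      exact idem_mul_h hA hhq
    rw [vec, vec, hy, hx, h2, mul_assoc p.1.1, h1]
    simp only [mul_assoc]
  rw [hvec]
  -- The product h h' is expanded in the basis again. Its terms with nontrivial outer factors pass
  -- through smaller weights; the others are single elements of H and yield basis elements of weight
  -- l.
  have hmid := mem_span_row_col hA (T := T) (i := (T.src p : I)) (j := (T.tgt q : I))
    (a := p.1.2.1 * q.1.2.1) (by rw [← mul_assoc, idem_mul_h hA hhp])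
    (by rw [mul_assoc, h_mul_idem hA hhq])
  refine Submodule.span_induction (p := fun a _ =>
    p.1.1 * a * q.1.2.2 ∈ T.weightSpan (Set.Iic l)) ?_ ?_ ?_ ?_ hmid
  · rintro _ ⟨r, ⟨hr, hc⟩, rfl⟩
    have hxr := T.fst_mem r
    have hyr := T.snd_mem r
    have hhr := T.mid_mem r
    rw [hr] at hxr
    rw [hc] at hyr
    by_cases hsr : T.src r = T.src p
    swap
    · have := ih' (T.src r) (hwp ▸ T.X_ne _ _ (Ne.symm hsr) ⟨_, hxr⟩) (p.1.1 * r.1.1)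
        (r.1.2.1 * r.1.2.2 * q.1.2.2)
      rw [mul_assoc p.1.1, x_mul_idem hA hxr] at this
      simpa only [vec, mul_assoc] using this
    by_cases htr : T.tgt r = T.tgt q
    swap
    · have := ih' (T.tgt r) (hwq ▸ T.Y_ne _ _ htr ⟨_, hyr⟩) (p.1.1 * r.1.1 * r.1.2.1)
        (r.1.2.2 * q.1.2.2)
      rw [mul_assoc, ← mul_assoc (e _), idem_mul_y hA hyr] at this
      simpa only [vec, mul_assoc] using this
    rw [hsr] at hxr hhr
    rw [htr] at hyr hhr
    rw [T.X_self, Set.mem_singleton_iff] at hxr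
    rw [T.Y_self, Set.mem_singleton_iff] at hyr
    have : p.1.1 * T.vec r * q.1.2.2 = T.vec (T.mkIndex hxp hhr hyq) := by
      rw [vec, hxr, hyr, idem_mul_h hA hhr, h_mul_idem hA hhr]
      rfl
    rw [this]
    exact vec_mem_weightSpan (by rw [weight_mkIndex hA, hwp]; exact Set.self_mem_Iic)
  · rw [mul_zero, zero_mul]
    exact zero_mem _
  · intro a b _ _ ha hb
    rw [mul_add, add_mul]
    exact add_mem ha hb
  · intro c a _ ha
    rw [mul_smul_comm, smul_mul_assoc]
    exact Submodule.smul_mem _ c ha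

end GradedTriangularBasis

end Triangular

/-! ### Ideals of lower sets of weights, and the layers of the stratification -/

section Stratification

variable {k : Type v} [Field k] {A : Type u} [Ring A] [Algebra k A]

namespace GradedTriangularBasis

variable {𝒜 : ℤ → Submodule k A} {I : Type w} {e : I → A} {L : Type w'} [PartialOrder L]
  {T : GradedTriangularBasis 𝒜 e L}

section WeightIdem

variable (hA : IsLocallyUnital 𝒜 e)

include hA

theorem idem_mul_weightIdem (s : T.S) : e s * T.weightIdem (T.dot s) = e s := by
  classical
  rw [weightIdem, Finset.mul_sum, Finset.sum_eq_single s]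
  · exact hA.orthogonal.idem s
  · exact fun t _ hts => hA.orthogonal.ortho fun h => hts (Subtype.ext h.symm)
  · intro h
    simp at h

theorem weightIdem_mul_idem (s : T.S) : T.weightIdem (T.dot s) * e s = e s := by
  classical
  rw [weightIdem, Finset.sum_mul, Finset.sum_eq_single s]
  · exact hA.orthogonal.idem s
  · exact fun t _ hts => hA.orthogonal.ortho fun h => hts (Subtype.ext h)
  · intro h
    simp at h

/-- A basis element of weight in Γ passes through some 1_s with weight in Γ, and A 1_s A stays in
weights at most that of s. -/
theorem mul_mem_weightSpan {Γ : Set L} (hΓ : IsLowerSet Γ) (a : A) {b : A}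
    (hb : b ∈ T.weightSpan Γ) : a * b ∈ T.weightSpan Γ := by
  have hle : T.weightSpan Γ ≤ (T.weightSpan Γ).comap (LinearMap.mulLeft k a) := by
    refine Submodule.span_le.2 ?_
    rintro _ ⟨p, hp, rfl⟩
    have := mul_idem_mul_mem hA (T.src p) (a * p.1.1) (p.1.2.1 * p.1.2.2)
    rw [mul_assoc a, x_mul_idem hA (T.fst_mem p), mul_assoc, ← mul_assoc p.1.1] at this
    exact weightSpan_mono (hΓ.Iic_subset hp) this
  exact hle hb

theorem mem_weightSpan_mul {Γ : Set L} (hΓ : IsLowerSet Γ) {a : A} (ha : a ∈ T.weightSpan Γ)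
    (b : A) : a * b ∈ T.weightSpan Γ := by
  have hle : T.weightSpan Γ ≤ (T.weightSpan Γ).comap (LinearMap.mulRight k b) := by
    refine Submodule.span_le.2 ?_
    rintro _ ⟨p, hp, rfl⟩
    have := mul_idem_mul_mem hA (T.src p) p.1.1 (p.1.2.1 * p.1.2.2 * b)
    rw [x_mul_idem hA (T.fst_mem p), ← mul_assoc, ← mul_assoc] at this
    exact weightSpan_mono (hΓ.Iic_subset hp) this
  exact hle ha

theorem idem_mem_weightSpan {Γ : Set L} (hΓ : IsLowerSet Γ) {s : T.S} (hs : T.dot s ∈ Γ) :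
    e s ∈ T.weightSpan Γ := by
  have := mul_idem_mul_mem hA s 1 1
  rw [one_mul, mul_one] at this
  exact weightSpan_mono (hΓ.Iic_subset hs) this

theorem weightIdem_mem_weightSpan {Γ : Set L} (hΓ : IsLowerSet Γ) {l : L} (hl : l ∈ Γ) :
    T.weightIdem l ∈ T.weightSpan Γ := by
  refine sum_mem fun s hs => idem_mem_weightSpan hA hΓ ?_
  rw [Set.Finite.mem_toFinset] at hs
  exact hs.symm ▸ hl

end WeightIdem

variable (T) in
/-- The congruence modulo the ideal generated by the weight idempotents with weights in a given
set. -/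
def weightCon (Γ : Set L) : RingCon A :=
  (TwoSidedIdeal.span {a : A | ∃ m : L, m ∈ Γ ∧ a = T.weightIdem m}).ringCon

section Quotients

variable (hA : IsLocallyUnital 𝒜 e) {Γ : Set L} (hΓ : IsLowerSet Γ)

include hA hΓ

/-- The span is a two-sided ideal containing the e_μ; conversely x h y = x e_μ h y for μ the weight
of x h y. Hence the quotient inherits the remaining basis elements as a basis. -/
theorem weightCon_mk'_eq_zero {a : A} : (T.weightCon Γ).mk' a = 0 ↔ a ∈ T.weightSpan Γ := by
  rw [← TwoSidedIdeal.mem_ker, weightCon, TwoSidedIdeal.ker_ringCon_mk']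
  constructor
  · intro ha
    let J : TwoSidedIdeal A := TwoSidedIdeal.mk' (T.weightSpan Γ) (zero_mem _) add_mem neg_mem
      (fun {a b} hb => mul_mem_weightSpan hA hΓ a hb)
      (fun {a b} ha => mem_weightSpan_mul hA hΓ ha b)
    have hJ : TwoSidedIdeal.span {a : A | ∃ m : L, m ∈ Γ ∧ a = T.weightIdem m} ≤ J := by
      rw [TwoSidedIdeal.span_le]
      rintro _ ⟨m, hm, rfl⟩
      exact (TwoSidedIdeal.mem_mk' ..).2 (weightIdem_mem_weightSpan hA hΓ hm)
    exact (TwoSidedIdeal.mem_mk' ..).1 (hJ ha)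
  · intro ha
    refine Submodule.span_induction ?_ (TwoSidedIdeal.zero_mem _)
      (fun _ _ _ _ => TwoSidedIdeal.add_mem _) (fun c a _ ha => ?_) ha
    · rintro _ ⟨p, hp, rfl⟩
      have : p.1.1 * T.weightIdem (T.weight p) = p.1.1 := by
        rw [← x_mul_idem hA (T.fst_mem p), mul_assoc, weight, idem_mul_weightIdem hA]
      rw [vec, ← this]
      exact TwoSidedIdeal.mul_mem_right _ _ _ (TwoSidedIdeal.mul_mem_right _ _ _
        (TwoSidedIdeal.mul_mem_left _ _ _ (TwoSidedIdeal.subset_span ⟨_, hp, rfl⟩)))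
    · rw [Algebra.smul_def]
      exact TwoSidedIdeal.mul_mem_left _ _ _ ha

theorem weightCon_mk'_eq {a b : A} :
    (T.weightCon Γ).mk' a = (T.weightCon Γ).mk' b ↔ a - b ∈ T.weightSpan Γ := by
  rw [← weightCon_mk'_eq_zero hA hΓ, map_sub, sub_eq_zero]

end Quotients

section Step

variable (hA : IsLocallyUnital 𝒜 e) {Γ : Set L} (hΓ : IsLowerSet Γ) {l : L} (hl : l ∉ Γ)
  (hlt : ∀ m < l, m ∈ Γ)

theorem isLowerSet_not_ge (l : L) : IsLowerSet {m : L | ¬ l ≤ m} :=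
  fun _ _ hba ha hb => ha (hb.trans hba)

theorem subset_not_ge (hΓ : IsLowerSet Γ) (hl : l ∉ Γ) : Γ ⊆ {m : L | ¬ l ≤ m} :=
  fun _ hm hlm => hl (hΓ hlm hm)

theorem isLowerSet_insert (hΓ : IsLowerSet Γ) (hlt : ∀ m < l, m ∈ Γ) :
    IsLowerSet (insert l Γ) := by
  rintro a b hba (rfl | ha)
  · obtain rfl | h := hba.eq_or_lt
    · exact Set.mem_insert _ _
    · exact Set.mem_insert_of_mem _ (hlt _ h)
  · exact Set.mem_insert_of_mem _ (hΓ hba ha)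

include hA in
theorem upperCon_mk'_eq {a b : A} :
    (T.upperCon l).mk' a = (T.upperCon l).mk' b ↔ a - b ∈ T.weightSpan {m | ¬ l ≤ m} :=
  weightCon_mk'_eq hA (isLowerSet_not_ge l)

include hA hlt in
-- `A_λ` is defined modulo all weights ≱ λ, while the stratification kills only Γ. The two agree on
-- the corner: a basis element in e_λ A e_λ has weight at most λ, so if its weight is ≱ λ it is < λ
-- and lies in Γ.
theorem weightIdem_mul_mul_weightIdem_mem {a : A} (ha : a ∈ T.weightSpan {m | ¬ l ≤ m}) :
    T.weightIdem l * a * T.weightIdem l ∈ T.weightSpan Γ := by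
  classical
  have hle : T.weightSpan {m | ¬ l ≤ m} ≤
      (T.weightSpan Γ).comap (LinearMap.mulLeftRight k (T.weightIdem l, T.weightIdem l)) := by
    refine Submodule.span_le.2 ?_
    rintro _ ⟨p, hp, rfl⟩
    change T.weightIdem l * T.vec p * T.weightIdem l ∈ T.weightSpan Γ
    rw [weightIdem, Finset.sum_mul, Finset.sum_mul]
    refine sum_mem fun s hs => ?_
    rw [Finset.mul_sum]
    refine sum_mem fun t ht => ?_
    rw [Set.Finite.mem_toFinset] at hs ht
    by_cases hsr : e s * T.vec p * e t = 0
    · rw [hsr]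
      exact zero_mem _
    have hrow : T.row p = s := by
      by_contra h
      exact hsr (by rw [← idem_mul_vec hA, ← mul_assoc (e s),
        hA.orthogonal.ortho (Ne.symm h), zero_mul, zero_mul])
    have hcol : T.col p = t := by
      by_contra h
      exact hsr (by rw [← vec_mul_idem hA, mul_assoc, mul_assoc, hA.orthogonal.ortho h, mul_zero,
        mul_zero])
    have hx := T.fst_mem p
    rw [hrow] at hx
    have hne : s ≠ T.src p := by
      rintro rfl
      exact hp hs.ge
    have hw : T.weight p < l := hs ▸ T.X_ne _ _ hne ⟨_, hx⟩
    rw [← hrow, ← hcol, idem_mul_vec hA, vec_mul_idem hA]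
    exact vec_mem_weightSpan (hlt _ hw)
  exact hle ha

include hA in
theorem mk'_corner_eq {a : A} {x : T.Cartan hA l} (ha : (T.upperCon l).mk' a = x.1) :
    (T.upperCon l).mk' (T.weightIdem l * a * T.weightIdem l) = x.1 := by
  have hx := (Subsemigroup.mem_corner_iff (T.isIdempotentElem_upperIdem hA l)).1 x.2
  rw [map_mul, map_mul, ha]
  change T.upperIdem l * x.1 * T.upperIdem l = x.1
  rw [hx.1, hx.2]

include hA hlt in
theorem mk'_corner_congr (hΓ : IsLowerSet Γ) {a b : A}
    (h : (T.upperCon l).mk' a = (T.upperCon l).mk' b) :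
    (T.weightCon Γ).mk' (T.weightIdem l * a * T.weightIdem l) =
      (T.weightCon Γ).mk' (T.weightIdem l * b * T.weightIdem l) := by
  rw [weightCon_mk'_eq hA hΓ, ← sub_mul, ← mul_sub]
  exact weightIdem_mul_mul_weightIdem_mem hA hlt ((upperCon_mk'_eq hA).1 h)

/-- A representative in `A` of an element of `A_λ`. -/
noncomputable def cartanRep (x : T.Cartan hA l) : A :=
  (RingCon.mk'_surjective (T.upperCon l) x.1).choose

theorem mk'_cartanRep (x : T.Cartan hA l) : (T.upperCon l).mk' (cartanRep hA x) = x.1 :=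
  (RingCon.mk'_surjective (T.upperCon l) x.1).choose_spec

/-- The algebra `A_λ` as a corner of the quotient by the ideal of a lower set in whose complement
`λ` is minimal. -/
noncomputable def cartanHom : T.Cartan hA l →ₙ+* (T.weightCon Γ).Quotient where
  toFun x := (T.weightCon Γ).mk' (T.weightIdem l * cartanRep hA x * T.weightIdem l)
  map_mul' x y := by
    have he := (T.isIdempotentElem_weightIdem hA l).eq
    rw [← map_mul, mk'_corner_congr hA hlt hΓ (b := T.weightIdem l * cartanRep hA x *
      T.weightIdem l * (T.weightIdem l * cartanRep hA y * T.weightIdem l))]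
    · simp only [mul_assoc, he]
      simp only [← mul_assoc, he]
    · rw [mk'_cartanRep, map_mul, mk'_corner_eq hA (mk'_cartanRep hA x),
        mk'_corner_eq hA (mk'_cartanRep hA y)]
      rfl
  map_zero' := by
    rw [mk'_corner_congr hA hlt hΓ (b := 0), mul_zero, zero_mul, map_zero]
    rw [mk'_cartanRep, map_zero]
    rfl
  map_add' x y := by
    rw [← map_add, ← add_mul, ← mul_add]
    refine mk'_corner_congr hA hlt hΓ ?_
    rw [mk'_cartanRep, map_add, mk'_cartanRep, mk'_cartanRep]
    rfl

theorem cartanHom_apply {x : T.Cartan hA l} {a : A} (ha : (T.upperCon l).mk' a = x.1) :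
    cartanHom hA hΓ hlt x = (T.weightCon Γ).mk' (T.weightIdem l * a * T.weightIdem l) :=
  mk'_corner_congr hA hlt hΓ ((mk'_cartanRep hA x).trans ha.symm)

theorem cartanHom_one :
    cartanHom (l := l) hA hΓ hlt 1 = (T.weightCon Γ).mk' (T.weightIdem l) := by
  have he := (T.isIdempotentElem_weightIdem hA l).eq
  rw [cartanHom_apply hA hΓ hlt (a := T.weightIdem l) rfl, he, he]

include hl in
-- Γ consists of weights ≱ λ, so an element that vanishes modulo Γ already vanishes in `A_λ`.
theorem cartanHom_injective : Function.Injective (cartanHom (T := T) hA hΓ hlt) := by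
  rw [injective_iff_map_eq_zero]
  intro x hx
  obtain ⟨a, ha⟩ := RingCon.mk'_surjective (T.upperCon l) x.1
  rw [cartanHom_apply hA hΓ hlt ha, weightCon_mk'_eq_zero hA hΓ] at hx
  have := weightSpan_mono (subset_not_ge hΓ hl) hx
  rw [← weightCon_mk'_eq_zero hA (isLowerSet_not_ge l)] at this
  exact Subtype.ext ((mk'_corner_eq hA ha).symm.trans this)

variable (l) in
/-- The element of `A_λ` given by the corner element `e_λ a e_λ`. -/
noncomputable def toCartan (a : A) : T.Cartan hA l :=
  ⟨(T.upperCon l).mk' (T.weightIdem l * a * T.weightIdem l), by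
    refine (Subsemigroup.mem_corner_iff (T.isIdempotentElem_upperIdem hA l)).2 ⟨?_, ?_⟩
    · rw [upperIdem, ← map_mul, ← mul_assoc, ← mul_assoc,
        (T.isIdempotentElem_weightIdem hA l).eq]
    · rw [upperIdem, ← map_mul, mul_assoc (T.weightIdem l * a),
        (T.isIdempotentElem_weightIdem hA l).eq]⟩

theorem cartanHom_toCartan (a : A) : cartanHom hA hΓ hlt (toCartan hA l a) =
    (T.weightCon Γ).mk' (T.weightIdem l * a * T.weightIdem l) := by
  have he := (T.isIdempotentElem_weightIdem hA l).eq
  rw [cartanHom_apply hA hΓ hlt (a := T.weightIdem l * a * T.weightIdem l) rfl]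
  simp only [← mul_assoc, he]
  simp only [mul_assoc, he]

theorem cartanHom_toCartan_idem {s : T.S} (hs : T.dot s = l) :
    cartanHom hA hΓ hlt (toCartan hA l (e s)) = (T.weightCon Γ).mk' (e s) := by
  subst hs
  rw [cartanHom_toCartan, weightIdem_mul_idem hA, idem_mul_weightIdem hA]

variable (T) in
theorem weightCon_mono {Γ Δ : Set L} (h : Γ ⊆ Δ) : T.weightCon Γ ≤ T.weightCon Δ :=
  TwoSidedIdeal.ringCon_le_iff.1 (TwoSidedIdeal.span_mono fun _ ⟨m, hm, ha⟩ => ⟨m, h hm, ha⟩)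

variable (T l) in
/-- The elements `y` of the triangular basis with left weight `λ`. -/
abbrev LeftFamily : Type (max u w) :=
  {q : T.S × A // T.dot q.1 = l ∧ ∃ j, q.2 ∈ T.Y q.1 j}

/-- The linear map that sends `x h y` to `x h` and kills the basis elements with another third
factor. -/
noncomputable def stripRight (q : T.LeftFamily l) : A →ₗ[k] A := by
  classical
  exact T.basis.constr k fun p =>
    if T.tgt p = q.1.1 ∧ p.1.2.2 = q.1.2 then p.1.1 * p.1.2.1 else 0

theorem stripRight_vec_of_not {q : T.LeftFamily l} {p : T.Index}
    (h : ¬ (T.tgt p = q.1.1 ∧ p.1.2.2 = q.1.2)) : stripRight q (T.vec p) = 0 := by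
  rw [stripRight, ← T.basis_apply, Module.Basis.constr_basis, if_neg h]

theorem stripRight_vec {q : T.LeftFamily l} {p : T.Index}
    (h : T.tgt p = q.1.1 ∧ p.1.2.2 = q.1.2) : stripRight q (T.vec p) = p.1.1 * p.1.2.1 := by
  rw [stripRight, ← T.basis_apply, Module.Basis.constr_basis, if_pos h]

include hl in
-- Only basis elements of weight λ survive `stripRight`, and λ ∉ Γ; so the map reads off
-- coefficients modulo Γ.
theorem stripRight_eq_zero (q : T.LeftFamily l) {a : A} (ha : a ∈ T.weightSpan Γ) :
    stripRight q a = 0 := by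
  have hle : T.weightSpan Γ ≤ LinearMap.ker (stripRight q) := by
    refine Submodule.span_le.2 ?_
    rintro _ ⟨p, hp, rfl⟩
    refine stripRight_vec_of_not fun h => hl ?_
    rw [← q.2.1, ← h.1, T.dot_tgt]
    exact hp
  exact hle ha

include hA hlt in
-- Basis elements ending in y ∈ Y(t', t) with t' ≠ t have weight below λ; so modulo Γ the left ideal
-- generated by 1_t is spanned by the elements x h 1_t.
theorem mem_span_sup_weightSpan {t : T.S} (ht : T.dot t = l) (a : A) :
    a * e t ∈ Submodule.span k (T.vec '' {p | T.tgt p = t ∧ p.1.2.2 = e t}) ⊔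
      T.weightSpan Γ := by
  have hcol := mem_span_col hA (T := T) (j := (t : I)) (a := a * e t)
    (by rw [mul_assoc, (hA.orthogonal.idem _).eq])
  refine Submodule.span_le.2 ?_ hcol
  rintro _ ⟨p, hp : T.col p = t, rfl⟩
  have hy := T.snd_mem p
  rw [hp] at hy
  by_cases htp : T.tgt p = t
  · rw [htp, T.Y_self, Set.mem_singleton_iff] at hy
    exact Submodule.mem_sup_left (Submodule.subset_span ⟨p, ⟨htp, hy⟩, rfl⟩)
  · refine Submodule.mem_sup_right (vec_mem_weightSpan (hlt _ ?_))
    rw [← T.dot_tgt, ← ht]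
    exact T.Y_ne _ _ htp ⟨_, hy⟩

include hA in
theorem vec_mul_y {t : T.S} {p : T.Index} (hp : T.tgt p = t ∧ p.1.2.2 = e t) {j : I} {y : A}
    (hy : y ∈ T.Y t j) : T.vec p * y = T.vec (T.mkIndex (T.fst_mem p) (hp.1 ▸ T.mid_mem p) hy) := by
  change p.1.1 * p.1.2.1 * p.1.2.2 * y = p.1.1 * p.1.2.1 * y
  rw [hp.2, mul_assoc, idem_mul_y hA hy]

include hA in
theorem stripRight_mul_of_ne {q q' : T.LeftFamily l} (h : q ≠ q') {c : A}
    (hc : c ∈ Submodule.span k (T.vec '' {p | T.tgt p = q.1.1 ∧ p.1.2.2 = e q.1.1})) :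
    stripRight q' (c * q.1.2) = 0 := by
  obtain ⟨-, j, hy⟩ := q.2
  have hle : Submodule.span k (T.vec '' {p | T.tgt p = q.1.1 ∧ p.1.2.2 = e q.1.1}) ≤
      LinearMap.ker ((stripRight q').comp (LinearMap.mulRight k q.1.2)) := by
    refine Submodule.span_le.2 ?_
    rintro _ ⟨p, hp, rfl⟩
    change stripRight q' (T.vec p * q.1.2) = 0
    rw [vec_mul_y hA hp hy]
    refine stripRight_vec_of_not fun h' => h (Subtype.ext (Prod.ext ?_ h'.2))
    rw [← h'.1]
    exact (tgt_eq hA (hp.1 ▸ T.mid_mem p)).symm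
  exact hle hc

include hA in
-- Right multiplication by y takes the basis elements x h 1_t to the basis elements x h y, and
-- `stripRight` undoes it. With `stripRight_mul_of_ne` this gives the independence of the generators
-- y.
theorem stripRight_mul_self {q : T.LeftFamily l} {c : A}
    (hc : c ∈ Submodule.span k (T.vec '' {p | T.tgt p = q.1.1 ∧ p.1.2.2 = e q.1.1})) :
    stripRight q (c * q.1.2) = c := by
  obtain ⟨-, j, hy⟩ := q.2
  have hle : Submodule.span k (T.vec '' {p | T.tgt p = q.1.1 ∧ p.1.2.2 = e q.1.1}) ≤
      LinearMap.eqLocus ((stripRight q).comp (LinearMap.mulRight k q.1.2)) LinearMap.id := by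
    refine Submodule.span_le.2 ?_
    rintro _ ⟨p, hp, rfl⟩
    change stripRight q (T.vec p * q.1.2) = T.vec p
    have hh : p.1.2.1 ∈ T.H (T.src p) q.1.1 := hp.1 ▸ T.mid_mem p
    rw [vec_mul_y hA hp hy,
      stripRight_vec (p := T.mkIndex (T.fst_mem p) hh hy) ⟨tgt_eq hA hh, rfl⟩, vec, hp.2, mul_assoc,
      h_mul_idem hA hh]
    rfl
  exact hle hc

include hl in
/-- Passing from the ideal of `Γ` to the ideal of `Γ ∪ {λ}` is a stratifying quotient whose kernel
has the elements `y` of left weight `λ` as generators. -/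
theorem isLeftStratifying : IsLeftStratifying
    (RingCon.map (T.weightCon Γ) (T.weightCon (insert l Γ))
      (weightCon_mono T (Set.subset_insert l Γ)))
    (cartanHom hA hΓ hlt) (fun q : T.LeftFamily l => toCartan hA l (e q.1.1))
    (fun q => (T.weightCon Γ).mk' q.1.2) where
  surjective z := by
    obtain ⟨a, rfl⟩ := RingCon.mk'_surjective _ z
    exact ⟨(T.weightCon Γ).mk' a, rfl⟩
  injective := cartanHom_injective hA hΓ hl hlt
  exists_eq z := by
    obtain ⟨a, rfl⟩ := RingCon.mk'_surjective _ z
    exact ⟨toCartan hA l a, by rw [cartanHom_toCartan, cartanHom_one, map_mul, map_mul]⟩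
  map_idem := by
    rw [cartanHom_one]
    exact (weightCon_mk'_eq_zero hA (isLowerSet_insert hΓ hlt)).2
      (weightIdem_mem_weightSpan hA (isLowerSet_insert hΓ hlt) (Set.mem_insert _ _))
  idem_mul q := by
    obtain ⟨hq, j, hy⟩ := q.2
    rw [cartanHom_toCartan_idem hA hΓ hlt hq, ← map_mul, idem_mul_y hA hy]
  exists_linearCombination z hz := by
    obtain ⟨a, rfl⟩ := RingCon.mk'_surjective _ z
    have ha : a ∈ T.weightSpan (insert l Γ) :=
      (weightCon_mk'_eq_zero hA (isLowerSet_insert hΓ hlt)).1 hz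
    refine (LinearMap.mem_range (f := Finsupp.linearCombination _ _)).1 ?_
    rw [Finsupp.range_linearCombination]
    refine Submodule.span_induction ?_ (zero_mem _) (fun a b _ _ => ?_) (fun c a _ => ?_) ha
    · rintro _ ⟨p, hp | hp, rfl⟩
      · rw [vec, map_mul]
        refine Submodule.smul_mem _ _ (Submodule.subset_span ⟨⟨(T.tgt p, p.1.2.2), ?_⟩, rfl⟩)
        exact ⟨(T.dot_tgt p).trans hp, T.col p, T.snd_mem p⟩
      · rw [(weightCon_mk'_eq_zero hA hΓ).2 (vec_mem_weightSpan hp)]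
        exact zero_mem _
    · rw [map_add]
      exact add_mem
    · rw [Algebra.smul_def, map_mul]
      exact Submodule.smul_mem _ _
  mul_idem_eq_zero r hr q₀ := by
    classical
    choose a ha using fun q => RingCon.mk'_surjective (T.weightCon Γ) (r q)
    -- c q represents r q 1_t modulo Γ by a combination of elements x h 1_t, on which `stripRight`
    -- can recover c q from c q * y.
    choose c hc d hd hcd using fun q : T.LeftFamily l =>
      Submodule.mem_sup.1 (mem_span_sup_weightSpan hA hlt q.2.1 (a q))
    have hrm : ∀ q : T.LeftFamily l, (T.weightCon Γ).mk' (c q) =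
        r q * (T.weightCon Γ).mk' (e q.1.1) := fun q => by
      rw [← ha q, ← map_mul, ← hcd q, map_add, (weightCon_mk'_eq_zero hA hΓ).2 (hd q), add_zero]
    rw [cartanHom_toCartan_idem hA hΓ hlt q₀.2.1, ← hrm]
    by_cases hq₀ : q₀ ∈ r.support
    swap
    · rw [hrm, Finsupp.notMem_support_iff.1 hq₀, zero_mul]
    have hsum : ∑ q ∈ r.support, c q * q.1.2 ∈ T.weightSpan Γ := by
      rw [← weightCon_mk'_eq_zero hA hΓ, map_sum, ← hr, Finsupp.linearCombination_apply,
        Finsupp.sum]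
      refine Finset.sum_congr rfl fun q _ => ?_
      obtain ⟨-, j, hy⟩ := q.2
      rw [map_mul, hrm, mul_assoc, ← map_mul, idem_mul_y hA hy, smul_eq_mul]
    have := stripRight_eq_zero hl q₀ hsum
    rw [map_sum, Finset.sum_eq_single q₀ (fun q _ hq => stripRight_mul_of_ne hA hq (hc q))
      (fun h => absurd hq₀ h), stripRight_mul_self hA (hc q₀)] at this
    rw [this, map_zero]

end Step

end GradedTriangularBasis

end Stratification

/-! ### Corners of Noetherian rings -/

section Corner

/-- A left ideal J of eRe is recovered from RJ as its intersection with eRe, so chains in eRe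
inherit stabilization from R. -/
theorem IsIdempotentElem.isNoetherianRing_corner {R : Type*} [Ring R] [IsNoetherianRing R] {e : R}
    (he : IsIdempotentElem e) : IsNoetherianRing he.Corner := by
  have hmem : ∀ x : he.Corner, e * x.1 = x.1 ∧ x.1 * e = x.1 := fun x =>
    (Subsemigroup.mem_corner_iff he).1 x.2
  have key : ∀ (J : Ideal he.Corner) (x : he.Corner),
      x.1 ∈ Ideal.span (Subtype.val '' (J : Set he.Corner)) → x ∈ J := by
    intro J x hx
    -- The factor r is needed to carry the induction through multiplication by scalars of R; r = 1
    -- gives the claim.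
    have : ∀ r, ∃ y ∈ J, y.1 = e * r * x.1 := by
      refine Submodule.span_induction (p := fun z _ => ∀ r, ∃ y ∈ J, y.1 = e * r * z)
        ?_ ?_ ?_ ?_ hx
      · rintro _ ⟨z, hz, rfl⟩ r
        refine ⟨(⟨e * r * e, r, rfl⟩ : he.Corner) * z, J.mul_mem_left _ hz, ?_⟩
        change e * r * e * z.1 = _
        rw [mul_assoc, (hmem z).1]
      · exact fun r => ⟨0, J.zero_mem, (mul_zero _).symm⟩
      · intro z z' _ _ hz hz' r
        obtain ⟨y, hy, h⟩ := hz r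
        obtain ⟨y', hy', h'⟩ := hz' r
        exact ⟨y + y', J.add_mem hy hy', (congrArg₂ (· + ·) h h').trans (mul_add _ _ _).symm⟩
      · intro c z _ hz r
        obtain ⟨y, hy, h⟩ := hz (r * c)
        exact ⟨y, hy, by rw [h, smul_eq_mul]; simp only [mul_assoc]⟩
    obtain ⟨y, hy, h⟩ := this 1
    rw [mul_one, (hmem x).1] at h
    rwa [← Subtype.ext h]
  rw [isNoetherianRing_iff, ← monotone_stabilizes_iff_noetherian]
  intro f
  obtain ⟨n, hn⟩ := monotone_stabilizes_iff_noetherian.2 ‹IsNoetherianRing R›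
    ⟨fun i => Ideal.span (Subtype.val '' (f i : Set he.Corner)), fun i j hij =>
      Ideal.span_mono (Set.image_mono (f.monotone hij))⟩
  refine ⟨n, fun m hm => le_antisymm (f.monotone hm) fun x hx => key _ x ?_⟩
  have h := hn m hm
  change Ideal.span _ = Ideal.span _ at h
  rw [h]
  exact Ideal.subset_span ⟨x, hx, rfl⟩

end Corner

theorem FiniteLeftGlobalDim.of_subsingleton (R : Type u) [Ring R] [Subsingleton R] :
    FiniteLeftGlobalDim R := by
  refine ⟨1, fun M _ _ => ?_⟩
  have : Subsingleton M := Module.subsingleton R M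
  exact ProjDimLT.of_projective one_pos

/-! ### Finiteness from the unit, the grading of `A_λ`, and the theorem -/

section Final

variable {k : Type v} [Field k] {A : Type u} [Ring A] [Algebra k A]
  {𝒜 : ℤ → Submodule k A} {I : Type w} {e : I → A}

/-- Only finitely many row indices occur in the decomposition of 1; the sum of their idempotents
fixes 1 on the left, so it equals 1. -/
theorem IsLocallyUnital.exists_sum_eq_one (hA : IsLocallyUnital 𝒜 e) :
    ∃ J : Finset I, ∑ i ∈ J, e i = 1 := by
  classical
  obtain ⟨x, hx⟩ := hA.isInternal.2 1
  let J : Finset I := (DFinsupp.support x).image Prod.fst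
  refine ⟨J, ?_⟩
  rw [DirectSum.coeAddMonoidHom_eq_dfinsuppSum, DFinsupp.sum] at hx
  rw [← mul_one (∑ i ∈ J, e i), ← hx, Finset.mul_sum]
  refine Finset.sum_congr rfl fun p hp => ?_
  rw [Finset.sum_mul, Finset.sum_eq_single p.1]
  · exact mul_of_mem_sandwich (hA.orthogonal.idem _) (x p).2
  · intro i _ hi
    rw [← mul_of_mem_sandwich (hA.orthogonal.idem _) (x p).2, ← mul_assoc,
      hA.orthogonal.ortho hi, zero_mul]
  · intro h
    exact absurd (Finset.mem_image_of_mem _ hp) h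

theorem BoundedBelow.exists_forall_eq_bot (h : BoundedBelow 𝒜 e) (hA : IsLocallyUnital 𝒜 e) :
    ∃ N : ℤ, ∀ d < N, (𝒜 d).toAddSubgroup = ⊥ := by
  classical
  obtain ⟨J, hJ⟩ := hA.exists_sum_eq_one
  choose N hN using h
  obtain ⟨M, hM⟩ := ((J ×ˢ J).image fun p => N p.1 p.2).bddBelow
  refine ⟨M, fun d hd => ?_⟩
  rw [eq_bot_iff]
  intro a ha
  have : a = ∑ i ∈ J, ∑ j ∈ J, e i * a * e j := by
    simp only [← Finset.mul_sum, hJ, ← Finset.sum_mul, one_mul, mul_one]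
  rw [AddSubgroup.mem_bot, this]
  refine Finset.sum_eq_zero fun i hi => Finset.sum_eq_zero fun j hj => ?_
  have hd' : d < N i j := hd.trans_le
    (hM (Finset.mem_coe.2 (Finset.mem_image.2 ⟨(i, j), Finset.mem_product.2 ⟨hi, hj⟩, rfl⟩)))
  have := hN i j d hd'
  exact (Submodule.mem_bot k).1 (this ▸ Submodule.mem_map_of_mem ha)

namespace GradedTriangularBasis

variable {L : Type w'} [PartialOrder L] (T : GradedTriangularBasis 𝒜 e L)
  (hA : IsLocallyUnital 𝒜 e)

/-- Takes the weights below those occurring in the expansion of 1. For this Γ the quotient by the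
ideal of Γ is zero. -/
theorem exists_finite_isLowerSet :
    ∃ Γ : Set L, Γ.Finite ∧ IsLowerSet Γ ∧ (1 : A) ∈ T.weightSpan Γ := by
  refine ⟨⋃ p ∈ (T.basis.repr 1).support, Set.Iic (T.weight p), ?_, ?_, ?_⟩
  · exact (Finset.finite_toSet _).biUnion fun p _ => T.lower_finite _
  · exact isLowerSet_iUnion₂ fun p _ => isLowerSet_Iic _
  · refine Submodule.span_mono ?_ (T.basis.mem_span_repr_support 1)
    rintro _ ⟨p, hp, rfl⟩
    exact ⟨p, Set.mem_biUnion hp Set.self_mem_Iic, (T.basis_apply p).symm⟩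

include hA

theorem isNoetherianRing_cartan [IsNoetherianRing A] (l : L) :
    IsNoetherianRing (T.Cartan hA l) := by
  have : IsNoetherianRing (T.Upper l) :=
    isNoetherianRing_of_surjective A _ (T.upperCon l).mk' (RingCon.mk'_surjective _)
  exact (T.isIdempotentElem_upperIdem hA l).isNoetherianRing_corner

/-- Removing a maximal weight l from Γ leaves a lower set in whose complement l is minimal, so the
stratification bound applies. At Γ = ∅ the quotient is A. -/
theorem finiteLeftGlobalDim_of_weightCon (hdim : ∀ l, FiniteLeftGlobalDim (T.Cartan hA l))
    {Γ : Set L} (hfin : Γ.Finite) (hΓ : IsLowerSet Γ)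
    (h : FiniteLeftGlobalDim (T.weightCon Γ).Quotient) : FiniteLeftGlobalDim A := by
  induction hn : Γ.ncard generalizing Γ with
  | zero =>
    rw [Set.ncard_eq_zero hfin] at hn
    subst hn
    refine h.of_ringEquiv (RingEquiv.ofBijective (T.weightCon ∅).mk' ⟨?_, ?_⟩).symm
    · rw [injective_iff_map_eq_zero]
      intro a ha
      rw [weightCon_mk'_eq_zero hA hΓ, weightSpan] at ha
      simpa using ha
    · exact RingCon.mk'_surjective _
  | succ n ih =>
    have hne : Γ.Nonempty := by
      rw [← Set.ncard_pos hfin]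
      omega
    obtain ⟨l, hl⟩ := hfin.exists_maximal hne
    have hΓ' : IsLowerSet (Γ \ {l}) := by
      rintro a b hba ⟨ha, hal⟩
      refine ⟨hΓ hba ha, ?_⟩
      rintro rfl
      exact hal (le_antisymm (hl.2 ha hba) hba)
    have hins : insert l (Γ \ {l}) = Γ := Set.insert_sdiff_self_of_mem hl.1
    have hlt : ∀ m < l, m ∈ Γ \ {l} := fun m hm => ⟨hΓ hm.le hl.1, hm.ne⟩
    have hstrat := isLeftStratifying (T := T) hA hΓ' (fun h => h.2 rfl) hlt
    refine ih (hfin.subset Set.sdiff_subset) hΓ'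
      (hstrat.finiteLeftGlobalDim (hins.symm ▸ h) (hdim l)) ?_
    rw [Set.ncard_sdiff_singleton_of_mem hl.1, hn, Nat.add_sub_cancel]

theorem finiteLeftGlobalDim (hdim : ∀ l, FiniteLeftGlobalDim (T.Cartan hA l)) :
    FiniteLeftGlobalDim A := by
  obtain ⟨Γ, hfin, hΓ, h1⟩ := T.exists_finite_isLowerSet
  refine T.finiteLeftGlobalDim_of_weightCon hA hdim hfin hΓ ?_
  have : Subsingleton (T.weightCon Γ).Quotient := by
    rw [← subsingleton_iff_zero_eq_one, eq_comm, ← map_one (T.weightCon Γ).mk']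
    exact (weightCon_mk'_eq_zero hA hΓ).2 h1
  exact .of_subsingleton _

omit hA in
theorem vec_mem [GradedAlgebra 𝒜] (p : T.Index) : ∃ d, T.vec p ∈ 𝒜 d := by
  obtain ⟨a, ha⟩ := (T.X_mem _ _ _ (T.fst_mem p)).1
  obtain ⟨b, hb⟩ := (T.H_mem _ _ _ (T.mid_mem p)).1
  obtain ⟨c, hc⟩ := (T.Y_mem _ _ _ (T.snd_mem p)).1
  exact ⟨_, SetLike.mul_mem_graded (SetLike.mul_mem_graded ha hb) hc⟩

theorem weightIdem_mem_zero [GradedAlgebra 𝒜] (l : L) : T.weightIdem l ∈ 𝒜 0 := by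
  refine sum_mem fun s _ => ?_
  obtain ⟨d, hd⟩ := hA.homogeneous s
  have hdd := SetLike.mul_mem_graded hd hd
  rw [(hA.orthogonal.idem s).eq] at hdd
  -- An idempotent of degree d also has degree d + d; so d = 0 or the idempotent is zero.
  by_cases h : d = 0
  · exact h ▸ hd
  · have h0 := DirectSum.decompose_of_mem_ne 𝒜 hdd (j := d) (by omega)
    rw [DirectSum.decompose_of_mem_same 𝒜 hd] at h0
    rw [h0]
    exact zero_mem _

omit hA in
-- The basis is homogeneous, so the ideals spanned by parts of it are graded and the projections
-- descend to the quotients.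
theorem grProj_mem_weightSpan [GradedAlgebra 𝒜] (Γ : Set L) (d : ℤ) {a : A}
    (ha : a ∈ T.weightSpan Γ) :
    grProj (fun d => (𝒜 d).toAddSubgroup) d a ∈ T.weightSpan Γ := by
  have hle : T.weightSpan Γ ≤ (T.weightSpan Γ).comap (GradedAlgebra.proj 𝒜 d) := by
    refine Submodule.span_le.2 ?_
    rintro _ ⟨p, hp, rfl⟩
    obtain ⟨n, hn⟩ := T.vec_mem p
    change (GradedAlgebra.proj 𝒜 d) (T.vec p) ∈ T.weightSpan Γ
    rw [GradedAlgebra.proj_apply]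
    by_cases h : n = d
    · subst h
      rw [DirectSum.decompose_of_mem_same 𝒜 hn]
      exact vec_mem_weightSpan hp
    · rw [DirectSum.decompose_of_mem_ne 𝒜 hn h]
      exact zero_mem _
  exact hle ha

/-- The projections of the graded quotient `A_{≥ λ}`. -/
noncomputable def upperProj [GradedAlgebra 𝒜] (l : L) (d : ℤ) : T.Upper l →+ T.Upper l :=
  (T.upperCon l).mk'.toAddMonoidHom.liftOfSurjective (RingCon.mk'_surjective _)
    ⟨(T.upperCon l).mk'.toAddMonoidHom.comp (grProj (fun d => (𝒜 d).toAddSubgroup) d),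
      fun _ ha => (weightCon_mk'_eq_zero hA (isLowerSet_not_ge l)).2
        (T.grProj_mem_weightSpan _ d
          ((weightCon_mk'_eq_zero hA (isLowerSet_not_ge l)).1 ha))⟩

theorem upperProj_mk' [GradedAlgebra 𝒜] (l : L) (d : ℤ) (a : A) :
    T.upperProj hA l d ((T.upperCon l).mk' a) =
      (T.upperCon l).mk' (grProj (fun d => (𝒜 d).toAddSubgroup) d a) :=
  AddMonoidHom.liftOfRightInverse_comp_apply ..

theorem upperProj_upperIdem_mul [GradedAlgebra 𝒜] (l : L) (d : ℤ) (x : T.Upper l) :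
    T.upperProj hA l d (T.upperIdem l * x) = T.upperIdem l * T.upperProj hA l d x := by
  obtain ⟨a, rfl⟩ := RingCon.mk'_surjective _ x
  rw [upperIdem, ← map_mul, upperProj_mk', upperProj_mk', ← map_mul]
  exact congrArg _ (DirectSum.coe_decompose_mul_of_left_mem_zero 𝒜 (T.weightIdem_mem_zero hA l))

theorem upperProj_mul_upperIdem [GradedAlgebra 𝒜] (l : L) (d : ℤ) (x : T.Upper l) :
    T.upperProj hA l d (x * T.upperIdem l) = T.upperProj hA l d x * T.upperIdem l := by
  obtain ⟨a, rfl⟩ := RingCon.mk'_surjective _ x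
  rw [upperIdem, ← map_mul, upperProj_mk', upperProj_mk', ← map_mul]
  exact congrArg _ (DirectSum.coe_decompose_mul_of_right_mem_zero 𝒜 (T.weightIdem_mem_zero hA l))

/-- The projections of the graded algebra `A_λ`. -/
noncomputable def cartanProj [GradedAlgebra 𝒜] (l : L) (d : ℤ) :
    T.Cartan hA l →+ T.Cartan hA l where
  toFun x := ⟨T.upperProj hA l d x.1, by
    have hx := (Subsemigroup.mem_corner_iff (T.isIdempotentElem_upperIdem hA l)).1 x.2
    refine (Subsemigroup.mem_corner_iff (T.isIdempotentElem_upperIdem hA l)).2 ⟨?_, ?_⟩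
    · rw [← upperProj_upperIdem_mul, hx.1]
    · rw [← upperProj_mul_upperIdem, hx.2]⟩
  map_zero' := Subtype.ext (map_zero _)
  map_add' x y := Subtype.ext (map_add _ x.1 y.1)

noncomputable instance [GradedAlgebra 𝒜] (l : L) : GradedRing (T.cartanGrading hA l) where
  one_mem := ⟨T.weightIdem l, T.weightIdem_mem_zero hA l, rfl⟩
  mul_mem := by
    rintro i j x y ⟨a, ha, hx⟩ ⟨b, hb, hy⟩
    exact ⟨a * b, SetLike.mul_mem_graded ha hb, (map_mul _ a b).trans (congrArg₂ _ hx hy)⟩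
  toDecomposition := by
    refine (isInternal_of_proj (T.cartanProj hA l) ?_ ?_ fun x => ?_).chooseDecomposition
    · rintro d x ⟨a, ha, hx⟩
      refine Subtype.ext ?_
      change T.upperProj hA l d x.1 = x.1
      rw [← hx, upperProj_mk', grProj_same (fun d => (𝒜 d).toAddSubgroup) ha]
    · rintro d d' h x ⟨a, ha, hx⟩
      refine Subtype.ext ?_
      change T.upperProj hA l d' x.1 = 0
      rw [← hx, upperProj_mk', grProj_of_ne (fun d => (𝒜 d).toAddSubgroup) ha h, map_zero]
    · obtain ⟨a, ha⟩ := RingCon.mk'_surjective (T.upperCon l) x.1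
      have hx : x = toCartan hA l a := Subtype.ext (mk'_corner_eq hA ha).symm
      rw [hx]
      clear hx ha
      induction a using gr_induction (fun d => (𝒜 d).toAddSubgroup) with
      | zero =>
        have : toCartan hA l 0 = 0 := Subtype.ext (by
          change (T.upperCon l).mk' (T.weightIdem l * 0 * T.weightIdem l) = 0
          rw [mul_zero, zero_mul, map_zero])
        rw [this]
        exact zero_mem _
      | hom d a ha =>
        refine AddSubgroup.mem_iSup_of_mem d ⟨T.weightIdem l * a * T.weightIdem l, ?_, rfl⟩
        have := SetLike.mul_mem_graded (SetLike.mul_mem_graded (T.weightIdem_mem_zero hA l) ha)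
          (T.weightIdem_mem_zero hA l)
        rwa [zero_add, add_zero] at this
      | add a b ha hb =>
        have : toCartan hA l (a + b) = toCartan hA l a + toCartan hA l b := Subtype.ext (by
          change (T.upperCon l).mk' (T.weightIdem l * (a + b) * T.weightIdem l) =
            (T.upperCon l).mk' (T.weightIdem l * a * T.weightIdem l) +
              (T.upperCon l).mk' (T.weightIdem l * b * T.weightIdem l)
          rw [mul_add, add_mul, map_add])
        rw [this]
        exact add_mem ha hb

end GradedTriangularBasis

end Final

theorem mainTheorem9 {k : Type v} [Field k] [IsAlgClosed k] {A : Type u} [Ring A] [Algebra k A]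
    (𝒜 : ℤ → Submodule k A) [GradedAlgebra 𝒜] {I : Type w} (e : I → A)
    (hA : IsLocallyUnital 𝒜 e) (hfin : LocallyFiniteDim 𝒜 e) (hbdd : BoundedBelow 𝒜 e)
    {L : Type w'} [PartialOrder L] (T : GradedTriangularBasis 𝒜 e L)
    (hleft : LeftGradedNoetherian (fun d => (𝒜 d).toAddSubgroup))
    (hright : RightGradedNoetherian (fun d => (𝒜 d).toAddSubgroup))
    (hdim : ∀ l : L, FiniteLeftGradedGlobalDim (T.cartanGrading hA l) ∨
      FiniteRightGradedGlobalDim (T.cartanGrading hA l)) :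
    FiniteLeftGradedGlobalDim (fun d => (𝒜 d).toAddSubgroup) ∧
      FiniteRightGradedGlobalDim (fun d => (𝒜 d).toAddSubgroup) := by
  obtain ⟨N, hN⟩ := hbdd.exists_forall_eq_bot hA
  have : IsNoetherianRing A := hleft.isNoetherianRing hN
  have : IsNoetherianRing Aᵐᵒᵖ :=
    LeftGradedNoetherian.isNoetherianRing hright fun d hd => opGrading_eq_bot _ (hN d hd)
  have hcartan : ∀ l, FiniteLeftGlobalDim (T.Cartan hA l) := fun l => by
    have := T.isNoetherianRing_cartan hA l
    rcases hdim l with h | h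
    · exact h.finiteLeftGlobalDim
    -- Right dimension is converted to left dimension by the left Noetherian property of `A_λ`,
    -- inherited from A through quotient and corner.
    · exact FiniteLeftGlobalDim.of_op (FiniteLeftGradedGlobalDim.finiteLeftGlobalDim h)
  have h := T.finiteLeftGlobalDim hA hcartan
  -- The right-hand statement comes from the left one because A is also right Noetherian.
  exact ⟨h.finiteLeftGradedGlobalDim _, FiniteLeftGlobalDim.finiteLeftGradedGlobalDim _ h.op⟩
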